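/- Let $K$ be a field and $n \ge 0$ an integer. Let $Q_n$ be the associative unital $K$-algebra with generators $u(A)$, $\emptyset \neq A \subseteq [n]=\{1,\dots,n\}$, and relations $$\sum_{C,D \subseteq A} [u(C \cup \{i\}), u(D \cup \{j\})] = \Big(\sum_{E \subseteq A} u(E \cup \{i,j\})\Big) \sum_{F \subseteq A}\big(u(F \cup \{i\}) - u(F \cup \{j\})\big)$$ for all $A \subseteq [n]$ and all distinct $i,j \in [n]\setminus A$. Let $P_n$ be the quotient of $Q_n$ by the two-sided ideal generated by those $u(A)$ for which $A$ is neither a vertex $\{i\}$ nor an edge $\{i,i+1\}$ of the path with vertices $1,\dots,n$. It is graded with all generators in degree $1$. Let $ch(P_n)$ be the quadratic $K$-algebra with generators $v_1,\dots,v_n,e_{12},\dots,e_{n-1,n}$ whose relations say that any two of the $v_i$ commute, that $e_{i,i+1}$ and $e_{j,j+1}$ commute if $j>i+1$, and that $v_i$ and $e_{j,j+1}$ commute if $i\notin\{j,j+1\}$. For a quadratic algebra $A = T(V)/(R)$ with $V$ finite-dimensional and $R \subseteq V\otimes V$, the quadratic dual is $A^! = T(V^*)/(R^\perp)$, where $R^\perp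 \subseteq V^*\otimes V^* \cong (V\otimes V)^*$ is the annihilator of $R$. The Hilbert series of a graded algebra $B=\bigoplus_d B_d$ with finite-dimensional components is $\sum_d \dim_K(B_d)\, x^d$. Let $H_n(x) = \sum_{i \ge 0} H_n^i x^i$ be the Hilbert series of $ch(P_n)^!$. Then the Hilbert series of $P_n$ is $$\frac{1}{H_n(-x)},$$ and for every $i \ge 0$ $$H_n^i = \sum_{j=0}^{i} M(n,j)\binom{n-2j}{i-j},$$ where $M(n,j)$ is the number of matchings with $j$ edges of the path on $n$ vertices (so that only terms with $2j\le n$ contribute). -/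

import Mathlib

open scoped TensorProduct

noncomputable section

namespace PathKoszul

/-! ### Hilbert series of algebras generated in degree one -/

/-- The Hilbert series of a `K`-algebra `A` generated in degree one by a subspace `V`
(with homogeneous relations): the degree `d` component is `V ^ d`, the span of all products of
`d` elements of `V`, and the coefficient of `X ^ d` is its dimension. -/
def hilbertSeries (K : Type*) [Field K] {A : Type*} [Semiring A] [Algebra K A]
    (V : Submodule K A) : PowerSeries ℤ :=
  PowerSeries.mk fun d => (Module.finrank K (V ^ d : Submodule K A) : ℤ)

/-- If `V` is finite dimensional then so is every graded component, so that the dimensions in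
`hilbertSeries` are genuine ones. -/
theorem finite_component (K : Type*) [Field K] {A : Type*} [Semiring A] [Algebra K A]
    (V : Submodule K A) (hV : V.FG) (d : ℕ) : Module.Finite K (V ^ d : Submodule K A) :=
  Module.Finite.iff_fg.mpr (hV.pow d)

/-! ### Quadratic algebras and their quadratic duals -/

section Quadratic

variable (K : Type*) [Field K] {V : Type*} [AddCommGroup V] [Module K V]

/-- The inclusion of `V ⊗ V` in the tensor algebra `T(V)` as the component of degree two. -/
def degreeTwo : V ⊗[K] V →ₗ[K] TensorAlgebra K V :=
  LinearMap.mul' K (TensorAlgebra K V) ∘ₗ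
    TensorProduct.map (TensorAlgebra.ι K) (TensorAlgebra.ι K)

/-- The quadratic algebra `{V, R} = T(V) / (R)` for a space of relations `R ⊆ V ⊗ V`. -/
abbrev QuadAlg (R : Submodule K (V ⊗[K] V)) : Type _ :=
  RingQuot fun a b : TensorAlgebra K V => (∃ r ∈ R, a = degreeTwo K r) ∧ b = 0

/-- The degree one component of `{V, R}`: the image of `V`. -/
def QuadAlg.generators (R : Submodule K (V ⊗[K] V)) : Submodule K (QuadAlg K R) :=
  (LinearMap.range (TensorAlgebra.ι K (M := V))).map (RingQuot.mkAlgHom K _).toLinearMap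

/-- The relations `R^⊥ ⊆ V* ⊗ V*` of the quadratic dual `{V, R}^! = {V*, R^⊥}`: the elements
of `V* ⊗ V*` that vanish on `R` when regarded as functionals on `V ⊗ V`. -/
def dualRelations (R : Submodule K (V ⊗[K] V)) :
    Submodule K (Module.Dual K V ⊗[K] Module.Dual K V) :=
  R.dualAnnihilator.comap (TensorProduct.dualDistrib K V V)

end Quadratic

/-! ### The algebras `Q_n`, `Q_n(F)` and `P_n` -/

/-- The free generator `u(C ∪ {i})`; the generators are indexed by the nonempty subsets of the
set of nodes. -/
def freeU (K : Type*) [Field K] {n : ℕ} (i : Fin n) (C : Finset (Fin n)) :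
    FreeAlgebra K {A : Finset (Fin n) // A.Nonempty} :=
  FreeAlgebra.ι K ⟨insert i C, Finset.insert_nonempty i C⟩

/-- The defining relations of `Q_n`, one for each subset `A` of the nodes and each pair of
distinct nodes `i`, `j` outside `A`. -/
inductive QRel (K : Type*) [Field K] (n : ℕ) :
    FreeAlgebra K {A : Finset (Fin n) // A.Nonempty} →
      FreeAlgebra K {A : Finset (Fin n) // A.Nonempty} → Prop
  | rel (A : Finset (Fin n)) (i j : Fin n) (hi : i ∉ A) (hj : j ∉ A) (hij : i ≠ j) :
      QRel K n
        (∑ C ∈ A.powerset, ∑ D ∈ A.powerset,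
          (freeU K i C * freeU K j D - freeU K j D * freeU K i C))
        ((∑ E ∈ A.powerset, freeU K i (insert j E)) *
          ∑ F ∈ A.powerset, (freeU K i F - freeU K j F))

/-- The algebra `Q_n`. -/
abbrev Q (K : Type*) [Field K] (n : ℕ) : Type _ := RingQuot (QRel K n)

/-- The generator `u(A)` of `Q_n`. -/
def Q.u (K : Type*) [Field K] (n : ℕ) (A : {A : Finset (Fin n) // A.Nonempty}) : Q K n :=
  RingQuot.mkAlgHom K (QRel K n) (FreeAlgebra.ι K A)

/-- The algebra `Q_n(F)`: the quotient of `Q_n` by the ideal generated by all `u(A)`, `A ∉ F`. -/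
abbrev QF (K : Type*) [Field K] (n : ℕ) (F : Set (Finset (Fin n))) : Type _ :=
  RingQuot fun a b : Q K n =>
    (∃ A : {A : Finset (Fin n) // A.Nonempty}, A.1 ∉ F ∧ a = Q.u K n A) ∧ b = 0

/-- The degree one component of `Q_n(F)`: the span of the images of the generators `u(A)`. -/
def QF.generators (K : Type*) [Field K] (n : ℕ) (F : Set (Finset (Fin n))) :
    Submodule K (QF K n F) :=
  Submodule.span K (Set.range fun A => RingQuot.mkAlgHom K _ (Q.u K n A))

/-- A graph on `n` nodes as a complex: the faces are the vertices and the edges. -/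
def graphComplex {n : ℕ} (G : SimpleGraph (Fin n)) : Set (Finset (Fin n)) :=
  {A | (∃ i, A = {i}) ∨ ∃ i j, G.Adj i j ∧ A = {i, j}}

/-- The Hilbert series of the algebra `P_n = Q_n(F)`, `F` the `n`-vertex path. -/
def pathHilbert (K : Type*) [Field K] (n : ℕ) : PowerSeries ℤ :=
  hilbertSeries K (QF.generators K n (graphComplex (SimpleGraph.pathGraph n)))

/-! ### The algebra `ch(P_n)` -/

/-- The generators of `ch(P_n)`: one for each vertex and one for each edge of the path, with
`edge i` the edge that joins the vertices `i` and `i + 1`. -/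
inductive PathGen (n : ℕ) : Type
  | vertex (i : Fin n) : PathGen n
  | edge (i : Fin (n - 1)) : PathGen n

/-- The pairs of generators whose commutator is a relation of `ch(P_n)`: any two vertices, any
two edges without a common vertex, and a vertex and an edge that does not contain it. -/
inductive ChopPair (n : ℕ) : PathGen n → PathGen n → Prop
  | vertex_vertex (i j : Fin n) (h : (i : ℕ) < j) : ChopPair n (.vertex i) (.vertex j)
  | edge_edge (i j : Fin (n - 1)) (h : (i : ℕ) + 1 < j) : ChopPair n (.edge i) (.edge j)
  | vertex_edge (i : Fin n) (j : Fin (n - 1)) (h : (i : ℕ) < j ∨ (j : ℕ) + 1 < i) :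
      ChopPair n (.vertex i) (.edge j)

/-- The relations `a ⊗ b - b ⊗ a`, for `c a b`, on the vector space with basis `X`. -/
def commutatorRelations (K : Type*) [Field K] {X : Type*} (c : X → X → Prop) :
    Submodule K ((X →₀ K) ⊗[K] (X →₀ K)) :=
  Submodule.span K {t | ∃ a b : X, c a b ∧
    t = Finsupp.single a 1 ⊗ₜ[K] Finsupp.single b 1 -
      Finsupp.single b 1 ⊗ₜ[K] Finsupp.single a 1}

/-- The relations of the quadratic algebra `ch(P_n)`. -/
def chRelations (K : Type*) [Field K] (n : ℕ) :
    Submodule K ((PathGen n →₀ K) ⊗[K] (PathGen n →₀ K)) :=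
  commutatorRelations K (ChopPair n)

/-- `H_n(x)`, the Hilbert series of the quadratic dual `ch(P_n)^!`. -/
def chDualHilbert (K : Type*) [Field K] (n : ℕ) : PowerSeries ℤ :=
  hilbertSeries K (QuadAlg.generators K (dualRelations K (chRelations K n)))

/-! ### Matchings of the path -/

/-- `M(n, j)`: the number of matchings with `j` edges of the path on `n` vertices. -/
def pathMatchings (n j : ℕ) : ℕ :=
  Set.ncard {M : (SimpleGraph.pathGraph n).Subgraph | M.IsMatching ∧ M.edgeSet.ncard = j}

end PathKoszul

end

noncomputable section

namespace PathKoszul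

/-! ### Counting words by transfer matrices -/

section Counting

variable {X : Type*}

/-! Both Hilbert series count words, and the two kinds of words are complementary. Call the vertices
and edges of the path letters; `RightOf b a` says that `b` lies strictly to the right of `a`, with
no common node. This is a strict partial order, and two letters are comparable exactly when their
commutator is a relation of ch(P_n) (`chopPair_iff`).

In P_n, inclusion-exclusion over the sets A turns the relations of Q_n into one rule for every `b`
to the right of `a`: b * a equals a * b plus a correction that begins with the edge bridging the
gap. The correction occurs only if `a` and `b` are adjacent and not both edges
(`satisfiesRel_letterValue`, with converse `nodeRel_of_satisfiesRel`). Read from left to right, the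
rules rewrite every word into normal words, in which no letter is to the right of its successor. The
overlaps resolve (`act_overlap`), so the algebra acts on the span of the normal words. As in the
diamond lemma, the normal words therefore form a basis (`finrank_generators_pow`).

In ch(P_n)^! commuting generators become anticommuting ones and all other products, squares
included, vanish. The words sorted by `RightOf` span, and signed insertion into finite sets shows
that they are independent (`finrank_dual_generators_pow`).

Hence the two series count the chains for a relation R and for its complement. Their transfer
matrices add up to the all-ones matrix, which has rank one, and a telescoping sum shows that the
generating functions are inverse to each other up to signs (`sum_chainCount`); Koszulness is not
used. Finally, a chain for `RightOf` is a set of pairwise disjoint letters: a matching with j edges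
together with i - j of the n - 2j vertices that it leaves free (`card_clique`, `pathMatchings_eq`).
-/

/-- The number of words of length `d` all of whose consecutive letters are related by `R`. -/
def chainCount (R : X → X → Prop) (d : ℕ) : ℕ :=
  Nat.card {w : List X // w.length = d ∧ w.IsChain R}

/-- The number of words `w` of length `d` such that the word `x :: w` is a chain for `R`. -/
def chainCountFrom (R : X → X → Prop) (d : ℕ) (x : X) : ℕ :=
  Nat.card {w : List X // w.length = d ∧ (x :: w).IsChain R}

theorem finite_words [Finite X] (d : ℕ) (p : List X → Prop) :
    Finite {w : List X // w.length = d ∧ p w} :=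
  ((List.finite_length_eq X d).subset fun _ hw => hw.1 : {w : List X | w.length = d ∧ p w}.Finite)

theorem chainCount_zero (R : X → X → Prop) : chainCount R 0 = 1 := by
  rw [chainCount, Nat.card_eq_one_iff_exists]
  refine ⟨⟨[], rfl, List.isChain_nil⟩, ?_⟩
  rintro ⟨w, hw, -⟩
  exact Subtype.ext (List.length_eq_zero_iff.mp hw)

theorem chainCountFrom_zero (R : X → X → Prop) (x : X) : chainCountFrom R 0 x = 1 := by
  rw [chainCountFrom, Nat.card_eq_one_iff_exists]
  refine ⟨⟨[], rfl, List.isChain_singleton x⟩, ?_⟩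
  rintro ⟨w, hw, -⟩
  exact Subtype.ext (List.length_eq_zero_iff.mp hw)

/-- A word of positive length is its first letter followed by the other letters. -/
def wordsSuccEquiv (d : ℕ) (p : List X → Prop) :
    {w : List X // w.length = d + 1 ∧ p w} ≃
      Σ x : X, {w : List X // w.length = d ∧ p (x :: w)} where
  toFun
    | ⟨x :: w, h⟩ => ⟨x, w, by simpa using h.1, h.2⟩
  invFun
    | ⟨x, w, h⟩ => ⟨x :: w, by simpa using h.1, h.2⟩
  left_inv := by
    rintro ⟨w, h⟩
    cases w with
    | nil => simp at h
    | cons x w => rfl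
  right_inv := by
    rintro ⟨x, w, h⟩
    rfl

theorem chainCount_succ [Fintype X] (R : X → X → Prop) (d : ℕ) :
    chainCount R (d + 1) = ∑ x, chainCountFrom R d x := by
  have := fun x : X => finite_words d fun w => (x :: w).IsChain R
  rw [chainCount, Nat.card_congr (wordsSuccEquiv d _), Nat.card_sigma]
  rfl

theorem chainCountFrom_succ [Fintype X] (R : X → X → Prop) [DecidableRel R] (d : ℕ) (x : X) :
    chainCountFrom R (d + 1) x = ∑ y, if R x y then chainCountFrom R d y else 0 := by
  have := fun y : X => finite_words d fun w => (x :: y :: w).IsChain R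
  rw [chainCountFrom, Nat.card_congr (wordsSuccEquiv d _), Nat.card_sigma]
  refine Finset.sum_congr rfl fun y _ => ?_
  by_cases h : R x y
  · simp only [List.isChain_cons_cons, h, true_and, if_true]
    rfl
  · simp [List.isChain_cons_cons, h]

open Classical in
/-- The transfer matrix of a relation. -/
def transferMatrix (R : X → X → Prop) : Matrix X X ℤ :=
  Matrix.of fun x y => if R x y then 1 else 0

open Matrix

theorem transferMatrix_compl (R : X → X → Prop) :
    transferMatrix R + transferMatrix (fun x y => ¬R x y) = Matrix.of fun _ _ => (1 : ℤ) := by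
  ext x y
  by_cases h : R x y <;> simp [transferMatrix, h]

variable [Fintype X] [DecidableEq X]

theorem chainCountFrom_eq (R : X → X → Prop) (d : ℕ) :
    (fun x => (chainCountFrom R d x : ℤ)) = (transferMatrix R ^ d) *ᵥ 1 := by
  classical
  induction d with
  | zero => ext x; simp [chainCountFrom_zero]
  | succ d ih =>
    rw [pow_succ', ← Matrix.mulVec_mulVec, ← ih]
    ext x
    rw [chainCountFrom_succ]
    simp [Matrix.mulVec, dotProduct, transferMatrix]

theorem chainCount_succ_eq (R : X → X → Prop) (d : ℕ) :
    (chainCount R (d + 1) : ℤ) = 1 ⬝ᵥ ((transferMatrix R ^ d) *ᵥ 1) := by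
  rw [← chainCountFrom_eq, chainCount_succ]
  simp [dotProduct]

/-- The two transfer matrices A and B add up to the all-ones matrix J, so the right side is 1ᵀ A^k J
B^m 1. Since J is a column of ones times a row of ones, this factors into the two counts. -/
theorem chainCount_mul (R : X → X → Prop) (k m : ℕ) :
    (chainCount R (k + 1) * chainCount (fun x y => ¬R x y) (m + 1) : ℤ) =
      1 ⬝ᵥ ((transferMatrix R ^ (k + 1) * transferMatrix (fun x y => ¬R x y) ^ m) *ᵥ 1) +
      1 ⬝ᵥ ((transferMatrix R ^ k * transferMatrix (fun x y => ¬R x y) ^ (m + 1)) *ᵥ 1) := by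
  set A := transferMatrix R
  set B := transferMatrix fun x y => ¬R x y
  have h : A ^ (k + 1) * B ^ m + A ^ k * B ^ (m + 1) =
      A ^ k * (Matrix.of fun _ _ => (1 : ℤ)) * B ^ m := by
    rw [← transferMatrix_compl R, mul_add, add_mul, pow_succ, pow_succ']
    simp only [mul_assoc]
    rfl
  have hJ : ∀ v : X → ℤ, (Matrix.of fun _ _ => (1 : ℤ) : Matrix X X ℤ) *ᵥ v = (1 ⬝ᵥ v) • 1 := by
    intro v
    ext x
    simp [Matrix.mulVec, dotProduct]
  rw [← dotProduct_add, ← Matrix.add_mulVec, h, chainCount_succ_eq, chainCount_succ_eq,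
    ← Matrix.mulVec_mulVec, ← Matrix.mulVec_mulVec, hJ, Matrix.mulVec_smul, dotProduct_smul,
    smul_eq_mul, mul_comm]

/-- The generating functions of the chains for a relation and for its complement are inverse to
each other up to signs. -/
theorem sum_chainCount (R : X → X → Prop) (d : ℕ) :
    ∑ k ∈ Finset.range (d + 2), (-1 : ℤ) ^ k * (chainCount R k *
      chainCount (fun x y => ¬R x y) (d + 1 - k)) = 0 := by
  set A := transferMatrix R
  set B := transferMatrix fun x y => ¬R x y
  -- The inner terms of the alternating sum are differences of neighbouring values of `g` and
  -- telescope to g d - g 0. The two extreme terms, in which one of the counts is 1, cancel this.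
  let g : ℕ → ℤ := fun k => (-1) ^ k * (1 ⬝ᵥ ((A ^ k * B ^ (d - k)) *ᵥ 1))
  have hk : ∀ k ∈ Finset.range d, (-1 : ℤ) ^ (k + 1) * (chainCount R (k + 1) *
      chainCount (fun x y => ¬R x y) (d + 1 - (k + 1))) = g (k + 1) - g k := by
    intro k hk
    obtain ⟨m, rfl⟩ : ∃ m, d = k + m + 1 := ⟨d - k - 1, by have := Finset.mem_range.mp hk; omega⟩
    rw [show k + m + 1 + 1 - (k + 1) = m + 1 by omega, chainCount_mul]
    simp only [g]
    rw [show k + m + 1 - (k + 1) = m by omega, show k + m + 1 - k = m + 1 by omega]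
    ring
  rw [Finset.sum_range_succ, Finset.sum_range_succ', Finset.sum_congr rfl hk,
    Finset.sum_range_sub, Nat.sub_self, chainCount_zero, chainCount_zero, Nat.sub_zero,
    chainCount_succ_eq, chainCount_succ_eq]
  simp only [g, Nat.sub_self, Nat.sub_zero, pow_zero, one_mul, mul_one]
  push_cast
  ring

end Counting

/-! ### The letters of the infinite path and the rewriting of words -/

/-- The vertices `(i, false)` and the edges `(i, true)` of the infinite path: the edge `(i, true)`
joins `i` and `i + 1`. -/
abbrev Letter : Type := ℕ × Bool

namespace Letter

/-- The right end of a vertex or an edge. -/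
def hi (l : Letter) : ℕ := l.1 + if l.2 then 1 else 0

@[simp] theorem hi_vertex (i : ℕ) : hi (i, false) = i := rfl

@[simp] theorem hi_edge (i : ℕ) : hi (i, true) = i + 1 := rfl

theorem le_hi (l : Letter) : l.1 ≤ l.hi := Nat.le_add_right _ _

/-- `RightOf b a`: the letter `b` lies strictly to the right of the letter `a`. -/
def RightOf (b a : Letter) : Prop := a.hi < b.1

instance : DecidableRel RightOf := fun b a => inferInstanceAs (Decidable (a.hi < b.1))

theorem RightOf.trans {a b c : Letter} (h : RightOf a b) (h' : RightOf b c) : RightOf a c :=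
  (h'.trans_le b.le_hi).trans h

/-- The edge that ends at the left end of `b`. -/
def mid (b : Letter) : Letter := (b.1 - 1, true)

section Coefficients

variable (K : Type*) [Field K]

/-- The coefficient of `mid b * b` in the rewriting of `b * a`. -/
def coeffLeft (b a : Letter) : K := if a.hi + 1 = b.1 ∧ a.2 = false then 1 else 0

/-- The coefficient of `mid b * a` in the rewriting of `b * a`. -/
def coeffRight (b a : Letter) : K := if a.hi + 1 = b.1 ∧ b.2 = false then -1 else 0

end Coefficients

end Letter

open Letter

section Rewriting

variable (K : Type*) [Field K]

/-- The relations of the algebra of the infinite path, solved for the products `b * a` with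
`b` to the right of `a`. -/
def SatisfiesRel {B : Type*} [Ring B] [Algebra K B] (x : Letter → B) : Prop :=
  ∀ b a : Letter, RightOf b a →
    x b * x a = x a * x b + x (mid b) * (coeffLeft K b a • x b + coeffRight K b a • x a)

/-- A word is normal if no letter is to the right of its successor. -/
def Normal (w : List Letter) : Prop := w.IsChain fun b a => ¬RightOf b a

/-- The left multiplication by a letter on normal words of length `d`. -/
def act : ℕ → Letter → (List Letter →₀ K) →ₗ[K] (List Letter →₀ K)
  | 0, b => Finsupp.linearCombination K fun w => Finsupp.single (b :: w) 1
  | d + 1, b => Finsupp.linearCombination K fun w =>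
      match w with
      -- A dummy value: the index is meant to be the length of the word.
      | [] => 0
      | a :: w =>
        if _h : RightOf b a then
          act (d + 1) a (act d b (Finsupp.single w 1)) +
            act (d + 1) (mid b) (coeffLeft K b a • act d b (Finsupp.single w 1) +
              coeffRight K b a • act d a (Finsupp.single w 1))
        else Finsupp.single (b :: a :: w) 1
-- The inner calls have a smaller index, and the outer ones use `a` or `mid b`, both of which begin
-- to the left of `b`.
termination_by d b => (d, b.1)
decreasing_by
  all_goals first
    | exact Prod.Lex.left _ _ (Nat.lt_succ_self d)
    | (apply Prod.Lex.right
       have h1 : a.hi < b.1 := _h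
       have h2 := a.le_hi
       try simp only [mid]
       omega)

variable {K}

theorem act_zero (b : Letter) (w : List Letter) :
    act K 0 b (Finsupp.single w 1) = Finsupp.single (b :: w) 1 := by
  rw [act, Finsupp.linearCombination_single, one_smul]

theorem act_succ_of_rightOf {b a : Letter} (h : RightOf b a) (d : ℕ) (w : List Letter) :
    act K (d + 1) b (Finsupp.single (a :: w) 1) =
      act K (d + 1) a (act K d b (Finsupp.single w 1)) +
        act K (d + 1) (mid b) (coeffLeft K b a • act K d b (Finsupp.single w 1) +
          coeffRight K b a • act K d a (Finsupp.single w 1)) := by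
  rw [act, Finsupp.linearCombination_single, one_smul]
  exact dif_pos h

theorem act_succ_of_not {b a : Letter} (h : ¬RightOf b a) (d : ℕ) (w : List Letter) :
    act K (d + 1) b (Finsupp.single (a :: w) 1) = Finsupp.single (b :: a :: w) 1 := by
  rw [act, Finsupp.linearCombination_single, one_smul]
  exact dif_neg h

theorem act_of_normal {b : Letter} {w : List Letter} (h : Normal (b :: w)) {d : ℕ}
    (hd : w.length = d) :
    act K d b (Finsupp.single w 1) = Finsupp.single (b :: w) 1 := by
  cases w with
  | nil => subst hd; exact act_zero b []
  | cons a w =>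
    subst hd
    exact act_succ_of_not (List.isChain_cons_cons.mp h).1 _ _

variable (K)

/-- The span of the normal words of length `d`. -/
def normalSpan (d : ℕ) : Submodule K (List Letter →₀ K) :=
  Submodule.span K ((fun w => Finsupp.single w 1) '' {w | w.length = d ∧ Normal w})

variable {K}

theorem single_mem_normalSpan {w : List Letter} (h : Normal w) {d : ℕ} (hd : w.length = d) :
    (Finsupp.single w 1 : List Letter →₀ K) ∈ normalSpan K d :=
  Submodule.subset_span ⟨w, ⟨hd, h⟩, rfl⟩

theorem eqOn_normalSpan {E : Type*} [AddCommGroup E] [Module K E] {d : ℕ}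
    {f g : (List Letter →₀ K) →ₗ[K] E}
    (h : ∀ w : List Letter, w.length = d → Normal w →
      f (Finsupp.single w 1) = g (Finsupp.single w 1))
    {m : List Letter →₀ K} (hm : m ∈ normalSpan K d) : f m = g m := by
  refine LinearMap.eqOn_span (s := (fun w => Finsupp.single w 1) ''
    {w : List Letter | w.length = d ∧ Normal w}) ?_ hm
  rintro _ ⟨w, ⟨h1, h2⟩, rfl⟩
  exact h w h1 h2

theorem map_mem_normalSpan {d e : ℕ} {f : (List Letter →₀ K) →ₗ[K] (List Letter →₀ K)}
    (h : ∀ w : List Letter, w.length = d → Normal w → f (Finsupp.single w 1) ∈ normalSpan K e)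
    {m : List Letter →₀ K} (hm : m ∈ normalSpan K d) : f m ∈ normalSpan K e := by
  suffices normalSpan K d ≤ (normalSpan K e).comap f from this hm
  rw [normalSpan, Submodule.span_le]
  rintro _ ⟨w, ⟨h1, h2⟩, rfl⟩
  exact h w h1 h2

theorem act_mem (d : ℕ) : ∀ (b : Letter) {m : List Letter →₀ K}, m ∈ normalSpan K d →
    act K d b m ∈ normalSpan K (d + 1) := by
  induction d with
  | zero =>
    intro b m hm
    refine map_mem_normalSpan (fun w hw _ => ?_) hm
    obtain rfl := List.length_eq_zero_iff.mp hw
    rw [act_zero]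
    exact single_mem_normalSpan (List.isChain_singleton b) rfl
  | succ d ihd =>
    intro b
    induction hr : b.1 using Nat.strong_induction_on generalizing b with
    | _ r ihr =>
    subst hr
    intro m hm
    refine map_mem_normalSpan (fun w hw hn => ?_) hm
    match w with
    | [] => simp at hw
    | a :: w =>
      have hw' : w.length = d := by simpa using hw
      by_cases h : RightOf b a
      · have h1 : a.hi < b.1 := h
        have h2 := a.le_hi
        have hm' := single_mem_normalSpan (K := K) (List.IsChain.of_cons hn) hw'
        rw [act_succ_of_rightOf h]
        refine add_mem (ihr a.1 (by omega) a rfl (ihd b hm'))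
          (ihr (b.1 - 1) (by omega) (mid b) rfl ?_)
        exact add_mem (Submodule.smul_mem _ _ (ihd b hm')) (Submodule.smul_mem _ _ (ihd a hm'))
      · rw [act_succ_of_not h]
        exact single_mem_normalSpan (List.isChain_cons_cons.mpr ⟨h, hn⟩) (by simp [hw'])

/-! ### Confluence of the rewriting -/

/-- The relation between the actions of two letters on the words of length `d`. -/
def ActRel (K : Type*) [Field K] (d : ℕ) (b a : Letter) : Prop :=
  ∀ m ∈ normalSpan K d, act K (d + 1) b (act K d a m) =
    act K (d + 1) a (act K d b m) +
      act K (d + 1) (mid b) (coeffLeft K b a • act K d b m + coeffRight K b a • act K d a m)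

theorem actRel_of_single {d : ℕ} {b a : Letter}
    (h : ∀ w : List Letter, w.length = d → Normal w →
      act K (d + 1) b (act K d a (Finsupp.single w 1)) =
        act K (d + 1) a (act K d b (Finsupp.single w 1)) +
          act K (d + 1) (mid b) (coeffLeft K b a • act K d b (Finsupp.single w 1) +
            coeffRight K b a • act K d a (Finsupp.single w 1))) : ActRel K d b a := by
  intro m hm
  refine eqOn_normalSpan (f := act K (d + 1) b ∘ₗ act K d a)
    (g := act K (d + 1) a ∘ₗ act K d b + act K (d + 1) (mid b) ∘ₗ
      (coeffLeft K b a • act K d b + coeffRight K b a • act K d a)) (fun w hw hn => ?_) hm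
  simpa using h w hw hn

theorem coeffLeft_eq_zero {b a : Letter} (h : a.hi + 1 < b.1) : coeffLeft K b a = 0 :=
  if_neg (by omega)

theorem coeffRight_eq_zero {b a : Letter} (h : a.hi + 1 < b.1) : coeffRight K b a = 0 :=
  if_neg (by omega)

/-- The overlap of two rewritable pairs is resolvable. -/
theorem act_overlap {k : ℕ} {b a z : Letter} (hba : RightOf b a) (haz : RightOf a z)
    (hlen : ∀ b a : Letter, RightOf b a → ActRel K k b a)
    (hrank : ∀ b a' : Letter, a'.1 < a.1 → RightOf b a' → ActRel K (k + 1) b a')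
    {m : List Letter →₀ K} (hm : m ∈ normalSpan K k) :
    act K (k + 2) b (act K (k + 1) z (act K k a m) +
        act K (k + 1) (mid a) (coeffLeft K a z • act K k a m + coeffRight K a z • act K k z m)) =
      act K (k + 2) a (act K (k + 1) z (act K k b m)) +
        act K (k + 2) (mid b) (coeffLeft K b a • act K (k + 1) z (act K k b m) +
          coeffRight K b a • (act K (k + 1) z (act K k a m) +
            act K (k + 1) (mid a) (coeffLeft K a z • act K k a m +
              coeffRight K a z • act K k z m))) := by
  have h1 : a.hi < b.1 := hba
  have h2 : z.hi < a.1 := haz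
  have h3 := a.le_hi
  have h4 := z.le_hi
  have hbz : RightOf b z := hba.trans haz
  have hbe : RightOf b (mid a) := show a.1 - 1 + 1 < b.1 by omega
  have hfz : RightOf (mid b) z := show z.hi < b.1 - 1 by omega
  have hez : (mid a).1 < a.1 := show a.1 - 1 < a.1 by omega
  have ma := act_mem k a hm
  have mb := act_mem k b hm
  have mz := act_mem k z hm
  -- At length k + 1 the right letter of every pair to be exchanged is `z` or `mid a`. Both begin
  -- before `a`, so `hrank` applies; pairs that act directly on `m` fall under `hlen`.
  have e1 := hrank b z (by omega) hbz _ ma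
  have e1' := hlen b z hbz _ hm
  have e2 := hlen b a hba _ hm
  have e3 := hrank b (mid a) hez hbe _ ma
  have e4 := hrank b (mid a) hez hbe _ mz
  have e5 := hrank a z (by omega) haz _ mb
  have e6 := hlen a z haz _ hm
  have e7 := hrank (mid b) z (by omega) hfz _ mb
  have e8 := hrank (mid b) z (by omega) hfz _ ma
  have c1 : coeffLeft K b z = 0 := coeffLeft_eq_zero (by omega)
  have c2 : coeffRight K b z = 0 := coeffRight_eq_zero (by omega)
  have c3 : coeffLeft K b (mid a) = 0 := if_neg (by simp [mid])
  have c4 : coeffRight K (mid b) z = 0 := if_neg (by simp [mid])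
  simp only [c1, c2, c3, c4, zero_smul, add_zero, zero_add, map_zero, map_add, map_smul]
    at e1 e1' e2 e3 e4 e5 e6 e7 e8 ⊢
  simp only [e1, e1', e2, e3, e4, e5, e7, e8, smul_add, map_add, map_smul]
  -- If `a` is a vertex next to `b`, then `mid b` begins at `a`, so `mid (mid b)` and `mid a` are
  -- the same edge and the corrections match. If `a` is an edge, one coefficient of each of the
  -- pairs (b, a) and (a, z) vanishes, and the edges `mid b` and `mid a` can be exchanged.
  rcases ha : a.2 with _ | _
  · have ha' : a.hi = a.1 := by simp [hi, ha]
    rcases Nat.lt_or_ge (a.1 + 1) b.1 with hab | hab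
    · have d1 : coeffLeft K b a = 0 := coeffLeft_eq_zero (by omega)
      have d2 : coeffRight K b a = 0 := coeffRight_eq_zero (by omega)
      have d3 : coeffRight K b (mid a) = 0 :=
        coeffRight_eq_zero (show a.1 - 1 + 1 + 1 < b.1 by omega)
      simp only [d1, d2, d3]
      module
    · have d1 : mid (mid b) = mid a := Prod.ext (show b.1 - 1 - 1 = a.1 - 1 by omega) rfl
      have d2 : coeffLeft K (mid b) z = coeffLeft K a z := by
        simp only [coeffLeft, mid, show b.1 - 1 = a.1 by omega]
      have d3 : coeffRight K b (mid a) = coeffRight K b a := by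
        simp only [coeffRight, mid, hi_edge, ha', show a.1 - 1 + 1 = a.1 by omega]
      simp only [d1, d2, d3]
      module
  · have ha' : a.hi = a.1 + 1 := by simp [hi, ha]
    have hfe : RightOf (mid b) (mid a) := show a.1 - 1 + 1 < b.1 - 1 by omega
    have e9 := hrank (mid b) (mid a) hez hfe _ ma
    have d1 : coeffLeft K b a = 0 := if_neg (by simp [ha])
    have d2 : coeffRight K a z = 0 := if_neg (by simp [ha])
    have d3 : coeffRight K b (mid a) = 0 :=
      coeffRight_eq_zero (show a.1 - 1 + 1 + 1 < b.1 by omega)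
    have d4 : coeffLeft K (mid b) z = 0 := coeffLeft_eq_zero (show z.hi + 1 < b.1 - 1 by omega)
    have d5 : coeffLeft K (mid b) (mid a) = 0 := if_neg (by simp [mid])
    have d6 : coeffRight K (mid b) (mid a) = 0 := if_neg (by simp [mid])
    simp only [d5, d6, zero_smul, add_zero, map_zero] at e9
    simp only [d1, d2, d3, d4, e9]
    module

/-- Induction on the length and, within it, on the left end of `a`. If `a` is to the right of the
first letter of the word, this is the overlap of two rewritable pairs; otherwise `a` followed by the
word is normal and the definition of the action gives the relation. -/
theorem act_rel (d : ℕ) : ∀ b a : Letter, RightOf b a → ActRel K d b a := by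
  induction d with
  | zero =>
    intro b a h
    refine actRel_of_single fun w hw hn => ?_
    obtain rfl := List.length_eq_zero_iff.mp hw
    rw [act_zero a, act_succ_of_rightOf h]
    simp only [act_zero]
  | succ d ihd =>
    intro b a
    induction hr : a.1 using Nat.strong_induction_on generalizing a b with
    | _ r ihr =>
    subst hr
    intro h
    refine actRel_of_single fun w hw hn => ?_
    match w with
    | [] => simp at hw
    | z :: w =>
      have hw' : w.length = d := by simpa using hw
      have hn' : Normal w := List.IsChain.of_cons hn
      by_cases haz : RightOf a z
      · have h' := act_overlap h haz ihd (fun b a' h1 h2 => ihr a'.1 h1 b a' rfl h2)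
          (single_mem_normalSpan (K := K) hn' hw')
        rw [act_succ_of_rightOf haz, h', act_succ_of_rightOf (h.trans haz)]
        have h1 : a.hi < b.1 := h
        have h2 : z.hi < a.1 := haz
        have h3 := a.le_hi
        rw [coeffLeft_eq_zero (b := b) (a := z) (by omega),
          coeffRight_eq_zero (b := b) (a := z) (by omega)]
        simp only [zero_smul, add_zero, map_zero]
      · rw [act_succ_of_not haz, act_succ_of_rightOf h,
          act_of_normal (List.isChain_cons_cons.mpr ⟨haz, hn⟩) hw, ← act_succ_of_not haz,
          act_of_normal (List.isChain_cons_cons.mpr ⟨haz, hn⟩) hw]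

variable (K)

open Classical in
/-- The left multiplication by a letter on the space with basis all words, which kills the words
that are not normal. -/
def mulLetter (b : Letter) : Module.End K (List Letter →₀ K) :=
  Finsupp.linearCombination K fun w =>
    if Normal w then act K w.length b (Finsupp.single w 1) else 0

variable {K}

theorem mulLetter_eq_act {d : ℕ} (b : Letter) {m : List Letter →₀ K} (hm : m ∈ normalSpan K d) :
    mulLetter K b m = act K d b m := by
  refine eqOn_normalSpan (fun w hw hn => ?_) hm
  rw [mulLetter, Finsupp.linearCombination_single, one_smul, if_pos hn, hw]

theorem mulLetter_of_not_normal (b : Letter) {w : List Letter} (h : ¬Normal w) :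
    mulLetter K b (Finsupp.single w 1) = 0 := by
  rw [mulLetter, Finsupp.linearCombination_single, one_smul, if_neg h]

theorem mulLetter_of_normal {b : Letter} {w : List Letter} (h : Normal (b :: w)) :
    mulLetter K b (Finsupp.single w 1) = Finsupp.single (b :: w) 1 := by
  rw [mulLetter_eq_act b (single_mem_normalSpan (List.IsChain.of_cons h) rfl), act_of_normal h rfl]

/-- On normal words this is `act_rel`. All other words are killed, so that the relation holds on the
whole space. -/
theorem satisfiesRel_mulLetter : SatisfiesRel K (mulLetter K) := by
  intro b a h
  refine Finsupp.lhom_ext' fun w => LinearMap.ext_ring ?_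
  change mulLetter K b (mulLetter K a (Finsupp.single w 1)) =
    mulLetter K a (mulLetter K b (Finsupp.single w 1)) +
      mulLetter K (mid b) (coeffLeft K b a • mulLetter K b (Finsupp.single w 1) +
        coeffRight K b a • mulLetter K a (Finsupp.single w 1))
  by_cases hn : Normal w
  · have hm := single_mem_normalSpan (K := K) hn rfl
    have ha := act_mem _ a hm
    have hb := act_mem _ b hm
    rw [mulLetter_eq_act a hm, mulLetter_eq_act b hm, mulLetter_eq_act b ha,
      mulLetter_eq_act a hb, mulLetter_eq_act _
        (add_mem (Submodule.smul_mem _ _ hb) (Submodule.smul_mem _ _ ha))]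
    exact act_rel _ b a h _ hm
  · simp [mulLetter_of_not_normal _ hn]

/-- No rewriting takes place when a normal word is built up from its end. The word is thus recovered
from its action on the empty word, which yields linear independence. -/
theorem prod_mulLetter {w : List Letter} (h : Normal w) :
    (w.map (mulLetter K)).prod (Finsupp.single [] 1) = Finsupp.single w 1 := by
  induction w with
  | nil => rfl
  | cons b w ih =>
    rw [List.map_cons, List.prod_cons, Module.End.mul_apply, ih (List.IsChain.of_cons h),
      mulLetter_of_normal h]

/-! ### Normal words span -/

section Spanning

variable {B : Type*} [Ring B] [Algebra K B] (x : Letter → B)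

/-- The product of the letters of a word. -/
def wordProd : (List Letter →₀ K) →ₗ[K] B :=
  Finsupp.linearCombination K fun w => (w.map x).prod

theorem wordProd_single (w : List Letter) :
    wordProd (K := K) x (Finsupp.single w 1) = (w.map x).prod := by
  rw [wordProd, Finsupp.linearCombination_single, one_smul]

/-- The recursion of `act` imitates `SatisfiesRel`, so evaluation in any algebra with these
relations turns it into left multiplication. -/
theorem wordProd_act (hx : SatisfiesRel K x) (d : ℕ) :
    ∀ (b : Letter) {m : List Letter →₀ K}, m ∈ normalSpan K d →
      wordProd x (act K d b m) = x b * wordProd x m := by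
  suffices ∀ (b : Letter) (w : List Letter), w.length = d → Normal w →
      wordProd x (act K d b (Finsupp.single w 1)) =
        x b * wordProd x (Finsupp.single w (1 : K)) from
    fun b m hm => eqOn_normalSpan (f := wordProd x ∘ₗ act K d b)
      (g := LinearMap.mulLeft K (x b) ∘ₗ wordProd x) (this b) hm
  induction d with
  | zero =>
    intro b w hw _
    obtain rfl := List.length_eq_zero_iff.mp hw
    rw [act_zero, wordProd_single, wordProd_single, List.map_cons, List.prod_cons]
  | succ d ihd =>
    intro b
    induction hr : b.1 using Nat.strong_induction_on generalizing b with
    | _ r ihr =>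
    subst hr
    intro w hw hn
    match w with
    | [] => simp at hw
    | a :: w =>
      have hw' : w.length = d := by simpa using hw
      have hn' : Normal w := List.IsChain.of_cons hn
      by_cases h : RightOf b a
      · have h1 : a.hi < b.1 := h
        have h2 := a.le_hi
        have hm := single_mem_normalSpan (K := K) hn' hw'
        have ha := act_mem _ a hm
        have hb := act_mem _ b hm
        have key : ∀ c : Letter, c.1 < b.1 → ∀ m ∈ normalSpan K (d + 1),
            wordProd x (act K (d + 1) c m) = x c * wordProd x m := fun c hc m hm =>
          eqOn_normalSpan (f := wordProd x ∘ₗ act K (d + 1) c)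
            (g := LinearMap.mulLeft K (x c) ∘ₗ wordProd x) (ihr c.1 hc c rfl) hm
        rw [act_succ_of_rightOf h, map_add, key a (by omega) _ hb,
          key (mid b) (show b.1 - 1 < b.1 by omega) _
            (add_mem (Submodule.smul_mem _ _ hb) (Submodule.smul_mem _ _ ha)),
          map_add, map_smul, map_smul, ihd b w hw' hn', ihd a w hw' hn', wordProd_single,
          wordProd_single, List.map_cons, List.prod_cons, ← mul_assoc (x b), hx b a h]
        simp only [add_mul, mul_assoc, smul_mul_assoc]
      · rw [act_succ_of_not h, wordProd_single, wordProd_single, List.map_cons, List.prod_cons]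

/-- Every product of letters is a linear combination of normal ones. -/
theorem prod_mem_map_wordProd (hx : SatisfiesRel K x) (w : List Letter) :
    (w.map x).prod ∈ (normalSpan K w.length).map (wordProd x) := by
  induction w with
  | nil =>
    exact ⟨_, single_mem_normalSpan List.isChain_nil rfl, wordProd_single x []⟩
  | cons b w ih =>
    obtain ⟨m, hm, h⟩ := ih
    refine ⟨_, act_mem _ b hm, ?_⟩
    rw [wordProd_act x hx _ b hm, h, List.map_cons, List.prod_cons]

end Spanning

end Rewriting

/-! ### Words in the generators -/

section Words

variable {K : Type*} [Field K]

theorem span_range_pow {B : Type*} [Semiring B] [Algebra K B] {X : Type*} (y : X → B) (d : ℕ) :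
    Submodule.span K (Set.range y) ^ d =
      Submodule.span K {p | ∃ w : List X, w.length = d ∧ (w.map y).prod = p} := by
  induction d with
  | zero =>
    rw [pow_zero, Submodule.one_eq_span]
    congr 1
    ext p
    constructor
    · rintro rfl
      exact ⟨[], rfl, rfl⟩
    · rintro ⟨w, hw, rfl⟩
      obtain rfl := List.length_eq_zero_iff.mp hw
      rfl
  | succ d ih =>
    rw [pow_succ', ih, Submodule.span_mul_span]
    congr 1
    ext p
    rw [Set.mem_mul]
    constructor
    · rintro ⟨_, ⟨a, rfl⟩, _, ⟨w, hw, rfl⟩, rfl⟩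
      exact ⟨a :: w, by simp [hw], by simp⟩
    · rintro ⟨w, hw, rfl⟩
      match w with
      | [] => simp at hw
      | a :: w => exact ⟨_, ⟨a, rfl⟩, _, ⟨w, by simpa using hw, rfl⟩, by simp⟩

theorem finrank_eq_natCard {E ι : Type*} [AddCommGroup E] [Module K E] [Finite ι] {f : ι → E}
    (hf : LinearIndependent K f) {V : Submodule K E} (hV : V = Submodule.span K (Set.range f)) :
    Module.finrank K V = Nat.card ι := by
  have := Fintype.ofFinite ι
  rw [hV, finrank_span_eq_card hf, Nat.card_eq_fintype_card]

end Words

/-! ### Vertices and edges of the finite path -/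

namespace PathGen

variable {n : ℕ}

/-- The vertex or edge of the infinite path that corresponds to a generator. -/
def toLetter : PathGen n → Letter
  | vertex i => (i, false)
  | edge i => (i, true)

theorem toLetter_hi_lt (g : PathGen n) : g.toLetter.hi < n := by
  cases g with
  | vertex i => exact i.2
  | edge i => have := i.2; simp only [toLetter, hi_edge]; omega

theorem toLetter_injective : Function.Injective (toLetter (n := n)) := by
  intro g h e
  cases g <;> cases h <;> simp_all [toLetter, Fin.ext_iff]

theorem exists_toLetter {l : Letter} (hl : l.hi < n) : ∃ g : PathGen n, g.toLetter = l := by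
  rcases l with ⟨i, _ | _⟩
  · exact ⟨vertex ⟨i, hl⟩, rfl⟩
  · exact ⟨edge ⟨i, by rw [hi_edge] at hl; omega⟩, rfl⟩

/-- The generators are the vertices and the edges. -/
def equivSum (n : ℕ) : PathGen n ≃ Fin n ⊕ Fin (n - 1) where
  toFun
    | vertex i => .inl i
    | edge i => .inr i
  invFun
    | .inl i => vertex i
    | .inr i => edge i
  left_inv := by rintro (i | i) <;> rfl
  right_inv := by rintro (i | i) <;> rfl

instance : Fintype (PathGen n) := Fintype.ofEquiv _ (equivSum n).symm

instance : DecidableEq (PathGen n) := (equivSum n).decidableEq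

/-- `g` lies strictly to the right of `h`. -/
def RightOf (g h : PathGen n) : Prop := Letter.RightOf g.toLetter h.toLetter

end PathGen

/-- The set of nodes of a vertex or an edge. -/
def face (n : ℕ) (l : Letter) : Finset (Fin n) :=
  Finset.univ.filter fun k => l.1 ≤ (k : ℕ) ∧ (k : ℕ) ≤ l.hi

theorem mem_face {n : ℕ} {l : Letter} {k : Fin n} :
    k ∈ face n l ↔ l.1 ≤ (k : ℕ) ∧ (k : ℕ) ≤ l.hi := by simp [face]

theorem face_vertex {n : ℕ} (i : Fin n) : face n (i, false) = {i} := by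
  ext k
  rw [mem_face, hi_vertex, Finset.mem_singleton, Fin.ext_iff]
  omega

theorem face_edge {n : ℕ} {i j : Fin n} (h : (i : ℕ) + 1 = j) : face n (i, true) = {i, j} := by
  ext k
  rw [mem_face, hi_edge, Finset.mem_insert, Finset.mem_singleton, Fin.ext_iff, Fin.ext_iff]
  omega

theorem face_injOn {n : ℕ} {l m : Letter} (hl : l.hi < n) (hm : m.hi < n)
    (h : face n l = face n m) : l = m := by
  have key : ∀ k < n, (l.1 ≤ k ∧ k ≤ l.hi) ↔ (m.1 ≤ k ∧ k ≤ m.hi) := fun k hk => by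
    simpa [mem_face] using Finset.ext_iff.mp h ⟨k, hk⟩
  have h1 := key l.1 (by have := l.le_hi; omega)
  have h2 := key l.hi hl
  have h3 := key m.1 (by have := m.le_hi; omega)
  have h4 := key m.hi hm
  have h5 := l.le_hi
  have h6 := m.le_hi
  have e1 : l.1 = m.1 := by omega
  have e2 : l.hi = m.hi := by omega
  refine Prod.ext e1 ?_
  rcases l with ⟨i, _ | _⟩ <;> rcases m with ⟨j, _ | _⟩ <;> simp_all

theorem mem_graphComplex_iff {n : ℕ} {A : Finset (Fin n)} :
    A ∈ graphComplex (SimpleGraph.pathGraph n) ↔ ∃ l : Letter, l.hi < n ∧ face n l = A := by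
  constructor
  · rintro (⟨i, rfl⟩ | ⟨i, j, hij, rfl⟩)
    · exact ⟨(i, false), i.2, face_vertex i⟩
    · rcases SimpleGraph.pathGraph_adj.mp hij with h | h
      · exact ⟨(i, true), by rw [hi_edge, h]; exact j.2, face_edge h⟩
      · exact ⟨(j, true), by rw [hi_edge, h]; exact i.2, by rw [face_edge h, Finset.pair_comm]⟩
  · rintro ⟨⟨i, _ | _⟩, hl, rfl⟩
    · exact Or.inl ⟨⟨i, hl⟩, face_vertex ⟨i, hl⟩⟩
    · rw [hi_edge] at hl
      exact Or.inr ⟨⟨i, by omega⟩, ⟨i + 1, hl⟩, SimpleGraph.pathGraph_adj.mpr (Or.inl rfl),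
        face_edge (i := ⟨i, by omega⟩) (j := ⟨i + 1, hl⟩) rfl⟩

theorem card_le_two {n : ℕ} {A : Finset (Fin n)}
    (h : A ∈ graphComplex (SimpleGraph.pathGraph n)) : A.card ≤ 2 := by
  rcases h with ⟨i, rfl⟩ | ⟨i, j, -, rfl⟩
  · simp
  · exact Finset.card_le_two

/-! ### The relations of `P_n` in terms of vertices and edges -/

section Relations

variable {K : Type*} [Field K] {n : ℕ} {B : Type*} [Ring B] [Algebra K B]

/-- The values of a family on the vertices and edges of the path, extended by zero. -/
def letterValue (u : Finset (Fin n) → B) (l : Letter) : B :=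
  if l.hi < n then u (face n l) else 0

theorem letterValue_vertex (u : Finset (Fin n) → B) (i : Fin n) :
    letterValue u (i, false) = u {i} := by
  rw [letterValue, if_pos (show hi (i, false) < n from i.2), face_vertex]

theorem letterValue_edge (u : Finset (Fin n) → B) {i j : Fin n} (h : (i : ℕ) + 1 = j) :
    letterValue u (i, true) = u {i, j} := by
  rw [letterValue, if_pos (show hi (i, true) < n by rw [hi_edge, h]; exact j.2), face_edge h]

theorem letterValue_of_le (u : Finset (Fin n) → B) {l : Letter} (h : n ≤ l.hi) :
    letterValue u l = 0 := if_neg h.not_gt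

/-- The sum of the values `u (C ∪ {i})` over the subsets `C` of `A`. -/
def starSum (u : Finset (Fin n) → B) (A : Finset (Fin n)) (i : Fin n) : B :=
  ∑ C ∈ A.powerset, u (insert i C)

/-- The relation of `Q_n` that belongs to `A`, `i` and `j`. -/
def NodeRel (u : Finset (Fin n) → B) (A : Finset (Fin n)) (i j : Fin n) : Prop :=
  starSum u A i * starSum u A j - starSum u A j * starSum u A i =
    (∑ E ∈ A.powerset, u (insert i (insert j E))) * (starSum u A i - starSum u A j)

theorem NodeRel.symm {u : Finset (Fin n) → B} {A : Finset (Fin n)} {i j : Fin n}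
    (h : NodeRel u A i j) : NodeRel u A j i := by
  rw [NodeRel] at h ⊢
  simp only [Finset.insert_comm j i]
  rw [← neg_sub, h, ← mul_neg, neg_sub]

/-- A family that vanishes off the vertices and the edges of the path. -/
def SupportedOnPath (u : Finset (Fin n) → B) : Prop :=
  ∀ A, A ∉ graphComplex (SimpleGraph.pathGraph n) → u A = 0

variable {u : Finset (Fin n) → B}

theorem value_pair (hu : SupportedOnPath u) {i k : Fin n} (hik : i ≠ k) :
    u {i, k} = (if (k : ℕ) = i + 1 then letterValue u (i, true) else 0) +
      if (k : ℕ) + 1 = i then letterValue u (k, true) else 0 := by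
  by_cases h1 : (k : ℕ) = i + 1
  · rw [if_pos h1, if_neg (by omega), add_zero, letterValue_edge u h1.symm]
  · rw [if_neg h1, zero_add]
    by_cases h2 : (k : ℕ) + 1 = i
    · rw [if_pos h2, letterValue_edge u h2, Finset.pair_comm]
    · rw [if_neg h2]
      refine hu _ ?_
      rintro (⟨l, hl⟩ | ⟨a, b, hab, h⟩)
      · have := congrArg Finset.card hl
        rw [Finset.card_pair hik] at this
        simp at this
      · have hi : i ∈ ({a, b} : Finset (Fin n)) := h ▸ Finset.mem_insert_self _ _
        have hk : k ∈ ({a, b} : Finset (Fin n)) := h ▸ by simp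
        rw [Finset.mem_insert, Finset.mem_singleton] at hi hk
        rw [SimpleGraph.pathGraph_adj] at hab
        rcases hi with rfl | rfl <;> rcases hk with rfl | rfl <;> omega

/-- A nonempty E gives a set of at least three nodes, which is not a face of the path. -/
theorem sum_pair (hu : SupportedOnPath u) {A : Finset (Fin n)} {i j : Fin n} (hi : i ∉ A) (hj : j ∉ A) (hij : i < j) :
    ∑ E ∈ A.powerset, u (insert i (insert j E)) =
      if (i : ℕ) + 1 = j then letterValue u (i, true) else 0 := by
  rw [Finset.sum_eq_single ∅]
  · rw [insert_empty_eq, value_pair hu hij.ne, if_neg (c := (j : ℕ) + 1 = i) (by omega), add_zero]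
    simp only [eq_comm]
  · intro E hE h
    refine hu _ fun hF => ?_
    have h1 := card_le_two hF
    have hEA := Finset.mem_powerset.mp hE
    have hj' : j ∉ E := fun h => hj (hEA h)
    have hi' : i ∉ insert j E := by
      rw [Finset.mem_insert, not_or]
      exact ⟨hij.ne, fun h => hi (hEA h)⟩
    rw [Finset.card_insert_of_notMem hi', Finset.card_insert_of_notMem hj'] at h1
    have := (Finset.nonempty_iff_ne_empty.mpr h).card_pos
    omega
  · intro h
    exact absurd (Finset.empty_mem_powerset A) h

theorem starSum_eq_sum (hu : SupportedOnPath u) {A : Finset (Fin n)} {i : Fin n} (hi : i ∉ A) :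
    starSum u A i = u {i} + ∑ k ∈ A, u {i, k} := by
  have h1 : insert ∅ (A.image fun k => ({k} : Finset (Fin n))) ⊆ A.powerset := by
    intro C hC
    rw [Finset.mem_insert, Finset.mem_image] at hC
    rcases hC with rfl | ⟨k, hk, rfl⟩
    · exact Finset.empty_mem_powerset A
    · rwa [Finset.mem_powerset, Finset.singleton_subset_iff]
  rw [starSum, ← Finset.sum_subset h1, Finset.sum_insert, Finset.sum_image]
  · rfl
  · exact fun a _ b _ h => Finset.singleton_injective h
  · simp
  · intro C hC hC'
    refine hu _ fun hF => ?_
    have h2 := card_le_two hF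
    have hCA := Finset.mem_powerset.mp hC
    rw [Finset.card_insert_of_notMem fun h => hi (hCA h)] at h2
    rw [Finset.mem_insert, Finset.mem_image, not_or] at hC'
    have h3 : C.card ≠ 0 := by simpa using hC'.1
    obtain ⟨k, rfl⟩ := Finset.card_eq_one.mp (show C.card = 1 by omega)
    exact hC'.2 ⟨k, hCA (Finset.mem_singleton_self k), rfl⟩

-- Besides the vertex `i`, only the edges from `i` to a neighbour in `A` survive. The difference `i
-- - 1` is used only when some `k + 1 = i`, so it is not truncated.
open Classical in
theorem starSum_eq (hu : SupportedOnPath u) {A : Finset (Fin n)} {i : Fin n} (hi : i ∉ A) :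
    starSum u A i = letterValue u (i, false) +
      (if ∃ k ∈ A, (k : ℕ) = i + 1 then letterValue u (i, true) else 0) +
      (if ∃ k ∈ A, (k : ℕ) + 1 = i then letterValue u (i - 1, true) else 0) := by
  have h : ∀ k ∈ A, u {i, k} = (if (k : ℕ) = i + 1 then letterValue u (i, true) else 0) +
      if (k : ℕ) + 1 = i then letterValue u (i - 1, true) else 0 := by
    intro k hk
    rw [value_pair hu (show i ≠ k by rintro rfl; exact hi hk)]
    congr 1
    by_cases h : (k : ℕ) + 1 = i
    · rw [if_pos h, if_pos h, ← h, Nat.add_sub_cancel]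
    · rw [if_neg h, if_neg h]
  rw [starSum_eq_sum hu hi, letterValue_vertex, Finset.sum_congr rfl h, Finset.sum_add_distrib,
    add_assoc]
  congr 2
  · by_cases h : ∃ k ∈ A, (k : ℕ) = i + 1
    · obtain ⟨k, hk, h⟩ := h
      rw [if_pos ⟨k, hk, h⟩, Finset.sum_eq_single_of_mem k hk fun l _ hl =>
        if_neg fun h' => hl (Fin.ext (by omega)), if_pos h]
    · rw [if_neg h, Finset.sum_eq_zero fun k hk => if_neg fun h' => h ⟨k, hk, h'⟩]
  · by_cases h : ∃ k ∈ A, (k : ℕ) + 1 = i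
    · obtain ⟨k, hk, h⟩ := h
      rw [if_pos ⟨k, hk, h⟩, Finset.sum_eq_single_of_mem k hk fun l _ hl =>
        if_neg fun h' => hl (Fin.ext (by omega)), if_pos h]
    · rw [if_neg h, Finset.sum_eq_zero fun k hk => if_neg fun h' => h ⟨k, hk, h'⟩]

theorem starSum_empty (u : Finset (Fin n) → B) (i : Fin n) :
    starSum u ∅ i = letterValue u (i, false) := by
  rw [starSum, Finset.powerset_empty, Finset.sum_singleton, letterValue_vertex]
  rfl

/-- The relations of `Q_n` imply the relations between the vertices and the edges. -/
theorem satisfiesRel_letterValue (hu : SupportedOnPath u)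
    (h : ∀ A i j, i ∉ A → j ∉ A → i ≠ j → NodeRel u A i j) :
    SatisfiesRel K (letterValue u) := by
  intro b a hba
  have hba' : a.hi < b.1 := hba
  rcases Nat.lt_or_ge b.hi n with hb | hb
  swap
  -- When `b` leaves the path, the term in `mid b * a` has a nonzero coefficient only for a vertex
  -- `b`, and then `mid b` leaves the path as well.
  · rw [letterValue_of_le u hb, zero_mul, mul_zero, zero_add, smul_zero, zero_add]
    by_cases hc : a.hi + 1 = b.1 ∧ b.2 = false
    · rw [letterValue_of_le u (l := mid b), zero_mul]
      have : b.hi = b.1 := by simp [hi, hc.2]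
      show n ≤ b.1 - 1 + 1
      omega
    · rw [coeffRight, if_neg hc, zero_smul, mul_zero]
  have hb1 := b.le_hi
  have ha1 := a.le_hi
  -- The two nodes are the ends of `a` and `b` that face each other. Putting the far end of an edge
  -- into `A` adds this edge to the star sum.
  have key : ∀ A : Finset (Fin n), ⟨a.hi, by omega⟩ ∉ A → ⟨b.1, by omega⟩ ∉ A →
      starSum u A ⟨a.hi, by omega⟩ * starSum u A ⟨b.1, by omega⟩ -
        starSum u A ⟨b.1, by omega⟩ * starSum u A ⟨a.hi, by omega⟩ =
      (if a.hi + 1 = b.1 then letterValue u (a.hi, true) else 0) *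
        (starSum u A ⟨a.hi, by omega⟩ - starSum u A ⟨b.1, by omega⟩) := by
    intro A hi hj
    have hij : (⟨a.hi, by omega⟩ : Fin n) < ⟨b.1, by omega⟩ := hba'
    have h' := h A _ _ hi hj hij.ne
    rwa [NodeRel, sum_pair hu hi hj hij] at h'
  have k0 := key ∅ (Finset.notMem_empty _) (Finset.notMem_empty _)
  rw [starSum_empty, starSum_empty] at k0
  rcases a with ⟨i, _ | _⟩ <;> rcases b with ⟨j, _ | _⟩ <;>
    simp only [hi_vertex, hi_edge] at hba' hb key k0 ⊢
  · by_cases hc : i + 1 = j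
    · subst hc
      simp [coeffLeft, coeffRight, mid] at k0 ⊢
      linear_combination (norm := noncomm_ring) -k0
    · simp [coeffLeft, coeffRight, hc] at k0 ⊢
      linear_combination (norm := noncomm_ring) -k0
  · have m1 : (⟨i, by omega⟩ : Fin n) ∉ ({⟨j + 1, hb⟩} : Finset (Fin n)) := by simp; omega
    have m2 : (⟨j, by omega⟩ : Fin n) ∉ ({⟨j + 1, hb⟩} : Finset (Fin n)) := by simp
    have k1 := key _ m1 m2
    rw [starSum_eq hu m1, starSum_eq hu m2] at k1
    simp only [Finset.mem_singleton, exists_eq_left] at k1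
    simp only [show ¬j + 1 = i + 1 by omega, show ¬j + 1 + 1 = i by omega,
      show ¬j + 1 + 1 = j by omega, if_true, if_false] at k1
    by_cases hc : i + 1 = j
    · subst hc
      simp [coeffLeft, coeffRight, mid] at k0 k1 ⊢
      linear_combination (norm := noncomm_ring) k0 - k1
    · simp [coeffLeft, coeffRight, hc] at k0 k1 ⊢
      linear_combination (norm := noncomm_ring) k0 - k1
  · have m1 : (⟨i + 1, by omega⟩ : Fin n) ∉ ({⟨i, by omega⟩} : Finset (Fin n)) := by simp
    have m2 : (⟨j, by omega⟩ : Fin n) ∉ ({⟨i, by omega⟩} : Finset (Fin n)) := by simp; omega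
    have k1 := key _ m1 m2
    rw [starSum_eq hu m1, starSum_eq hu m2] at k1
    simp only [Finset.mem_singleton, exists_eq_left] at k1
    simp only [show ¬i = i + 1 + 1 by omega, show ¬i = j + 1 by omega,
      show ¬i + 1 = j by omega, if_true, if_false] at k1
    by_cases hc : i + 1 + 1 = j
    · subst hc
      simp [coeffLeft, coeffRight, mid] at k0 k1 ⊢
      linear_combination (norm := noncomm_ring) k0 - k1
    · simp [coeffLeft, coeffRight, hc] at k0 k1 ⊢
      linear_combination (norm := noncomm_ring) k0 - k1
  -- Inclusion-exclusion over the two far ends isolates the commutator of the edges. The right sides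
  -- are additive in the star sums, so they cancel.
  · have m1 : (⟨i + 1, by omega⟩ : Fin n) ∉ ({⟨i, by omega⟩} : Finset (Fin n)) := by simp
    have m2 : (⟨j, by omega⟩ : Fin n) ∉ ({⟨i, by omega⟩} : Finset (Fin n)) := by simp; omega
    have m3 : (⟨i + 1, by omega⟩ : Fin n) ∉ ({⟨j + 1, hb⟩} : Finset (Fin n)) := by simp; omega
    have m4 : (⟨j, by omega⟩ : Fin n) ∉ ({⟨j + 1, hb⟩} : Finset (Fin n)) := by simp
    have m5 : (⟨i + 1, by omega⟩ : Fin n) ∉ ({⟨i, by omega⟩, ⟨j + 1, hb⟩} : Finset (Fin n)) := by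
      simp; omega
    have m6 : (⟨j, by omega⟩ : Fin n) ∉ ({⟨i, by omega⟩, ⟨j + 1, hb⟩} : Finset (Fin n)) := by
      simp; omega
    have k1 := key _ m1 m2
    have k2 := key _ m3 m4
    have k3 := key _ m5 m6
    rw [starSum_eq hu m1, starSum_eq hu m2] at k1
    rw [starSum_eq hu m3, starSum_eq hu m4] at k2
    rw [starSum_eq hu m5, starSum_eq hu m6] at k3
    simp only [Finset.mem_insert, Finset.mem_singleton, exists_eq_left, exists_eq_or_imp]
      at k1 k2 k3
    simp only [show ¬i = i + 1 + 1 by omega, show ¬i = j + 1 by omega,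
      show ¬i + 1 = j by omega, if_true, if_false] at k1
    simp only [show ¬i = i + 1 + 1 by omega, show ¬i = j + 1 by omega,
      show ¬i + 1 = j by omega, show ¬j + 1 = i + 1 + 1 by omega, show ¬j + 1 + 1 = i + 1 by omega,
      show ¬j + 1 + 1 = j by omega, if_true, if_false, or_true, or_false]
      at k1 k2 k3
    by_cases hc : i + 1 + 1 = j
    · subst hc
      simp [coeffLeft, coeffRight, mid] at k0 k1 k2 k3 ⊢
      linear_combination (norm := noncomm_ring) k1 + k2 - k0 - k3
    · simp [coeffLeft, coeffRight, hc] at k0 k1 k2 k3 ⊢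
      linear_combination (norm := noncomm_ring) k1 + k2 - k0 - k3

theorem letterValue_commute (hy : SatisfiesRel K (letterValue u)) {b a : Letter}
    (hba : RightOf b a) (hc : a.hi + 1 < b.1 ∨ a.2 = true ∧ b.2 = true) :
    Commute (letterValue u a) (letterValue u b) := by
  have h := hy b a hba
  have c1 : coeffLeft K b a = 0 := if_neg (by rcases hc with hc | hc <;> simp [hc]; omega)
  have c2 : coeffRight K b a = 0 := if_neg (by rcases hc with hc | hc <;> simp [hc]; omega)
  rw [c1, c2, zero_smul, zero_smul, add_zero, mul_zero, add_zero] at h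
  exact h.symm

/-- The relations between the vertices and the edges imply the relations of `Q_n`. -/
theorem nodeRel_of_satisfiesRel (hu : SupportedOnPath u)
    (hy : SatisfiesRel K (letterValue u)) {A : Finset (Fin n)} {i j : Fin n} (hi : i ∉ A)
    (hj : j ∉ A) (hij : i < j) : NodeRel u A i j := by
  have hij' : (i : ℕ) < j := hij
  rw [NodeRel, sum_pair hu hi hj hij, starSum_eq hu hi, starSum_eq hu hj]
  have hcomm : ∀ b a : Letter, a.hi < b.1 → (a.hi + 1 < b.1 ∨ a.2 = true ∧ b.2 = true) →
      Commute (letterValue u a) (letterValue u b) := fun b a => letterValue_commute hy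
  obtain ⟨i, hin⟩ := i
  obtain ⟨j, hjn⟩ := j
  simp only at hij' ⊢
  set p : B := if ∃ k ∈ A, (k : ℕ) + 1 = i then letterValue u (i - 1, true) else 0 with hp
  set q : B := if ∃ k ∈ A, (k : ℕ) = j + 1 then letterValue u (j, true) else 0 with hq
  have hpc : ∀ b : B, ((∃ k ∈ A, (k : ℕ) + 1 = i) → Commute (letterValue u (i - 1, true)) b) →
      Commute p b := by
    intro b hb
    rw [hp]
    split_ifs with h
    exacts [hb h, Commute.zero_left b]
  have hqc : ∀ b : B, Commute b (letterValue u (j, true)) → Commute b q := by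
    intro b hb
    rw [hq]
    split_ifs with h
    exacts [hb, Commute.zero_right b]
  have hpi : (∃ k ∈ A, (k : ℕ) + 1 = i) → i - 1 + 1 = i := by rintro ⟨k, -, hk⟩; omega
  have hpq : Commute p q := hpc _ fun h => hqc _ <| hcomm _ _
    (by have := hpi h; simp only [hi_edge]; omega) (Or.inr ⟨rfl, rfl⟩)
  have hvq : i + 1 < j → Commute (letterValue u (i, false)) q := fun h =>
    hqc _ (hcomm _ _ hij' (Or.inl h))
  have heq : i + 1 < j → Commute (letterValue u (i, true)) q := fun h =>
    hqc _ (hcomm _ _ h (Or.inr ⟨rfl, rfl⟩))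
  have hpv : i + 1 < j → Commute p (letterValue u (j, false)) := fun h =>
    hpc _ fun h' => hcomm _ _ (by have := hpi h'; simp only [hi_edge]; omega)
      (Or.inl (by have := hpi h'; simp only [hi_edge]; omega))
  have hpe : i + 1 < j → Commute p (letterValue u (j - 1, true)) := fun h =>
    hpc _ fun h' => hcomm _ _ (by have := hpi h'; simp only [hi_edge]; omega)
      (Or.inr ⟨rfl, rfl⟩)
  rcases Nat.lt_trichotomy (i + 2) j with h | h | h
  · rw [if_neg (c := i + 1 = j) (by omega), zero_mul, sub_eq_zero]
    have c1 := hvq (by omega)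
    have c2 := heq (by omega)
    have c3 := hpv (by omega)
    have c4 := hpe (by omega)
    have c5 := hcomm (j, false) (i, false) hij' (Or.inl (show i + 1 < j by omega))
    have c6 := hcomm (j, false) (i, true) (show i + 1 < j by omega) (Or.inl h)
    have c7 := hcomm (j - 1, true) (i, false) (show i < j - 1 by omega)
      (Or.inl (show i + 1 < j - 1 by omega))
    have c8 := hcomm (j - 1, true) (i, true) (show i + 1 < j - 1 by omega) (Or.inr ⟨rfl, rfl⟩)
    refine Commute.eq ?_
    clear_value p q
    split_ifs <;> try simp only [add_zero]
    all_goals repeat' first | assumption | apply Commute.add_left | apply Commute.add_right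
  -- With one node between, [v_i, e_{i+1}] and [e_i, v_{i+2}] need not vanish, but together they
  -- cancel [e_i, e_{i+1}].
  · subst h
    rw [if_neg (c := i + 1 = i + 2) (by omega), zero_mul, sub_eq_zero]
    have hmid : (∃ k ∈ A, (k : ℕ) + 1 = i + 2) ↔ ∃ k ∈ A, (k : ℕ) = i + 1 :=
      exists_congr fun k => and_congr_right fun _ => by omega
    rw [if_congr hmid rfl rfl]
    have c1 := hvq (by omega)
    have c2 := heq (by omega)
    have c3 := hpv (by omega)
    have c4 := hpe (by omega)
    have c5 := hcomm (i + 2, false) (i, false) hij' (Or.inl (show i + 1 < i + 2 by omega))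
    split_ifs with h
    · have r1 := hy (i + 2, false) (i, true) (show i + 1 < i + 2 by omega)
      have r2 := hy (i + 1, true) (i, false) (show i < i + 1 by omega)
      simp [coeffLeft, coeffRight, mid] at r1 r2
      rw [show i + 2 - 1 = i + 1 by omega] at c4 ⊢
      linear_combination (norm := noncomm_ring) c1.eq + c2.eq + c3.eq + c4.eq + c5.eq + hpq.eq
        - r1 - r2
    · refine Commute.eq ?_
      simp only [add_zero, Commute.add_left, Commute.add_right, c1, c3, c5, hpq]
  -- For neighbours, [v_i, v_{i+1}], [p, v_{i+1}] and [v_i, q] each supply their share of the right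
  -- side, and `p` and `q` commute.
  · obtain rfl : j = i + 1 := by omega
    have hP : ¬∃ k ∈ A, (k : ℕ) = i + 1 := by
      rintro ⟨k, hk, h⟩
      exact hj ((Fin.ext h : k = ⟨i + 1, hjn⟩) ▸ hk)
    have hP' : ¬∃ k ∈ A, (k : ℕ) + 1 = i + 1 := by
      rintro ⟨k, hk, h⟩
      exact hi ((Fin.ext (Nat.succ_injective h) : k = ⟨i, hin⟩) ▸ hk)
    rw [if_neg hP, if_neg hP', if_pos rfl, add_zero, add_zero]
    have r1 := hy (i + 1, false) (i, false) (show i < i + 1 by omega)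
    have r2 : letterValue u (i + 1, false) * p =
        p * letterValue u (i + 1, false) - letterValue u (i, true) * p := by
      rw [hp]
      split_ifs with h
      · have := hpi h
        have r := hy (i + 1, false) (i - 1, true) (show i - 1 + 1 < i + 1 by omega)
        simpa [coeffLeft, coeffRight, mid, this, ← sub_eq_add_neg] using r
      · simp
    have r3 : q * letterValue u (i, false) =
        letterValue u (i, false) * q + letterValue u (i, true) * q := by
      rw [hq]
      split_ifs with h
      · have r := hy (i + 1, true) (i, false) (show i < i + 1 by omega)
        simpa [coeffLeft, coeffRight, mid] using r
      · simp
    simp [coeffLeft, coeffRight, mid] at r1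
    linear_combination (norm := noncomm_ring) hpq.eq - r1 - r2 - r3

end Relations

/-! ### The Hilbert series of `P_n` -/

section PathAlgebra

variable {K : Type*} [Field K] {n : ℕ} {B : Type*} [Ring B] [Algebra K B]

theorem nodeRel_iff {u : Finset (Fin n) → B} {A : Finset (Fin n)} {i j : Fin n} :
    NodeRel u A i j ↔
      ∑ C ∈ A.powerset, ∑ D ∈ A.powerset,
        (u (insert i C) * u (insert j D) - u (insert j D) * u (insert i C)) =
      (∑ E ∈ A.powerset, u (insert i (insert j E))) *
        ∑ F ∈ A.powerset, (u (insert i F) - u (insert j F)) := by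
  rw [NodeRel, starSum, starSum, Finset.sum_mul_sum, Finset.sum_mul_sum, Finset.sum_sub_distrib,
    Finset.sum_comm (s := A.powerset) (t := A.powerset)
      (f := fun C D => u (insert j C) * u (insert i D)), ← Finset.sum_sub_distrib]
  simp only [Finset.sum_sub_distrib]

/-- The family that takes a given value at every vertex and every edge and vanishes elsewhere. -/
def faceValue (n : ℕ) (x : Letter → B) (A : Finset (Fin n)) : B :=
  open Classical in
  if h : ∃ l : Letter, l.hi < n ∧ face n l = A then x h.choose else 0

theorem faceValue_face (x : Letter → B) {l : Letter} (hl : l.hi < n) :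
    faceValue n x (face n l) = x l := by
  have h : ∃ m : Letter, m.hi < n ∧ face n m = face n l := ⟨l, hl, rfl⟩
  rw [faceValue, dif_pos h]
  exact congrArg x (face_injOn h.choose_spec.1 hl h.choose_spec.2)

theorem supportedOnPath_faceValue (x : Letter → B) : SupportedOnPath (faceValue n x) := by
  intro A hA
  rw [mem_graphComplex_iff] at hA
  exact dif_neg hA

theorem letterValue_faceValue (x : Letter → B) (l : Letter) :
    letterValue (faceValue n x) l = if l.hi < n then x l else 0 := by
  rw [letterValue]
  split_ifs with h
  · exact faceValue_face x h
  · rfl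

/-- The edge `mid b` ends where `b` begins, so it stays whenever `b` does and is cut off along with
a vertex `b`. For an edge `b` the term in `a` has coefficient zero. -/
theorem SatisfiesRel.restrict {x : Letter → B} (hx : SatisfiesRel K x) (n : ℕ) :
    SatisfiesRel K fun l => if l.hi < n then x l else 0 := by
  intro b a hba
  have hba' : a.hi < b.1 := hba
  have ha := a.le_hi
  have hb := b.le_hi
  have hm : (mid b).hi = b.1 := show b.1 - 1 + 1 = b.1 by omega
  by_cases h : b.hi < n
  · simp only [hm, show a.hi < n by omega, show b.1 < n by omega, h, if_true]
    exact hx b a hba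
  · simp only [h, if_false, zero_mul, mul_zero, smul_zero, zero_add]
    by_cases hc : a.hi + 1 = b.1 ∧ b.2 = false
    · have : b.hi = b.1 := by simp [hi, hc.2]
      rw [if_neg (by omega), zero_mul]
    · rw [coeffRight, if_neg hc, zero_smul, mul_zero]

variable (K n)

/-- The complex of the path. -/
abbrev pathComplex : Set (Finset (Fin n)) := graphComplex (SimpleGraph.pathGraph n)

/-- The value of a set of nodes in `P_n`. -/
def pathU (A : Finset (Fin n)) : QF K n (pathComplex n) :=
  if h : A.Nonempty then RingQuot.mkAlgHom K _ (Q.u K n ⟨A, h⟩) else 0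

theorem supportedOnPath_pathU : SupportedOnPath (pathU K n) := by
  intro A hA
  rw [pathU]
  split_ifs with h
  · exact (RingQuot.mkAlgHom_rel K ⟨⟨⟨A, h⟩, hA, rfl⟩, rfl⟩).trans (map_zero _)
  · rfl

theorem nodeRel_pathU (A : Finset (Fin n)) (i j : Fin n) (hi : i ∉ A) (hj : j ∉ A) (hij : i ≠ j) :
    NodeRel (pathU K n) A i j := by
  rw [nodeRel_iff]
  have h := congrArg (RingQuot.mkAlgHom K fun a b : Q K n =>
    (∃ A : {A : Finset (Fin n) // A.Nonempty}, A.1 ∉ pathComplex n ∧ a = Q.u K n A) ∧ b = 0)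
    (RingQuot.mkAlgHom_rel K (QRel.rel (K := K) A i j hi hj hij))
  have hu : ∀ (i : Fin n) C, pathU K n (insert i C) =
      RingQuot.mkAlgHom K _ (RingQuot.mkAlgHom K (QRel K n) (freeU K i C)) :=
    fun i C => dif_pos (Finset.insert_nonempty i C)
  simp only [map_sum, map_sub, map_mul] at h
  simpa only [hu] using h

theorem satisfiesRel_pathU : SatisfiesRel K (letterValue (pathU K n)) :=
  satisfiesRel_letterValue (supportedOnPath_pathU K n) (nodeRel_pathU K n)

variable {K n}

/-- The homomorphism from `P_n` given by elements that satisfy the relations. -/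
theorem exists_lift {u : Finset (Fin n) → B} (hu : SupportedOnPath u)
    (h : ∀ A i j, i ∉ A → j ∉ A → i ≠ j → NodeRel u A i j) :
    ∃ f : QF K n (pathComplex n) →ₐ[K] B, ∀ A, A.Nonempty → f (pathU K n A) = u A := by
  let f₀ : FreeAlgebra K {A : Finset (Fin n) // A.Nonempty} →ₐ[K] B :=
    FreeAlgebra.lift K fun A => u A.1
  have hf₀ : ∀ i C, f₀ (freeU K i C) = u (insert i C) := fun i C => FreeAlgebra.lift_ι_apply _ _
  have h₀ : ∀ ⦃a b⦄, QRel K n a b → f₀ a = f₀ b := by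
    rintro _ _ ⟨A, i, j, hi, hj, hij⟩
    have := nodeRel_iff.mp (h A i j hi hj hij)
    simpa only [map_sum, map_sub, map_mul, hf₀] using this
  let f₁ : Q K n →ₐ[K] B := RingQuot.liftAlgHom K ⟨f₀, h₀⟩
  have hf₁ : ∀ A, f₁ (Q.u K n A) = u A.1 := fun A => by
    simp only [f₁, Q.u, RingQuot.liftAlgHom_mkAlgHom_apply]
    exact FreeAlgebra.lift_ι_apply _ _
  refine ⟨RingQuot.liftAlgHom K ⟨f₁, ?_⟩, fun A hA => ?_⟩
  · rintro _ _ ⟨⟨A, hA, rfl⟩, rfl⟩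
    rw [hf₁, map_zero, hu _ hA]
  · rw [pathU, dif_pos hA, RingQuot.liftAlgHom_mkAlgHom_apply, hf₁]

variable (K n)

/-- The truncated operators satisfy the relations of `Q_n` by `nodeRel_of_satisfiesRel`, which
carries the independence of normal words over to P_n. -/
theorem exists_representation : ∃ f : QF K n (pathComplex n) →ₐ[K] Module.End K (List Letter →₀ K),
    ∀ g : PathGen n, f (letterValue (pathU K n) g.toLetter) = mulLetter K g.toLetter := by
  have hu := supportedOnPath_faceValue (n := n) (mulLetter K)
  have hy : SatisfiesRel K (letterValue (faceValue n (mulLetter K))) := by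
    rw [funext (letterValue_faceValue (mulLetter K))]
    exact satisfiesRel_mulLetter.restrict n
  obtain ⟨f, hf⟩ := exists_lift (K := K) hu fun A i j hi hj hij => by
    rcases lt_or_gt_of_ne hij with h | h
    · exact nodeRel_of_satisfiesRel hu hy hi hj h
    · exact (nodeRel_of_satisfiesRel hu hy hj hi h).symm
  refine ⟨f, fun g => ?_⟩
  have hg := g.toLetter_hi_lt
  have hne : (face n g.toLetter).Nonempty :=
    ⟨⟨g.toLetter.hi, hg⟩, mem_face.mpr ⟨g.toLetter.le_hi, le_rfl⟩⟩
  rw [letterValue, if_pos hg, hf _ hne, faceValue_face _ hg]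

theorem generators_eq : QF.generators K n (pathComplex n) =
    Submodule.span K (Set.range fun g : PathGen n => letterValue (pathU K n) g.toLetter) := by
  refine le_antisymm (Submodule.span_le.mpr ?_) (Submodule.span_le.mpr ?_)
  · rintro _ ⟨A, rfl⟩
    have hA : pathU K n A.1 = RingQuot.mkAlgHom K _ (Q.u K n A) := dif_pos A.2
    simp only [← hA]
    by_cases h : A.1 ∈ pathComplex n
    · obtain ⟨l, hl, h⟩ := mem_graphComplex_iff.mp h
      obtain ⟨g, rfl⟩ := PathGen.exists_toLetter hl
      refine Submodule.subset_span ⟨g, ?_⟩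
      simp only [letterValue, if_pos hl, h]
    · rw [supportedOnPath_pathU K n _ h]
      exact zero_mem _
  · rintro _ ⟨g, rfl⟩
    have hg := g.toLetter_hi_lt
    have hne : (face n g.toLetter).Nonempty :=
      ⟨⟨g.toLetter.hi, hg⟩, mem_face.mpr ⟨g.toLetter.le_hi, le_rfl⟩⟩
    simp only [letterValue, if_pos hg, pathU, dif_pos hne]
    exact Submodule.subset_span ⟨⟨_, hne⟩, rfl⟩

theorem normal_map_toLetter (w : List (PathGen n)) :
    Normal (w.map PathGen.toLetter) ↔ w.IsChain fun g h => ¬g.RightOf h := by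
  rw [Normal, List.isChain_map]
  rfl

/-- The normal words of length `d` form a basis of the component of degree `d` of `P_n`. -/
theorem finrank_generators_pow (d : ℕ) :
    Module.finrank K (QF.generators K n (pathComplex n) ^ d : Submodule K _) =
      chainCount (fun g h : PathGen n => ¬g.RightOf h) d := by
  have := finite_words (X := PathGen n) d fun w => w.IsChain fun g h => ¬g.RightOf h
  let y := letterValue (pathU K n)
  refine finrank_eq_natCard (K := K) (ι := {w : List (PathGen n) // w.length = d ∧
    w.IsChain fun g h => ¬g.RightOf h})
    (f := fun w => (w.1.map fun g => y g.toLetter).prod) ?_ ?_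
  · obtain ⟨f, hf⟩ := exists_representation K n
    let ev : QF K n (pathComplex n) →ₗ[K] (List Letter →₀ K) :=
      LinearMap.applyₗ (R := K) (M₂ := List Letter →₀ K) (Finsupp.single [] (1 : K)) ∘ₗ
        f.toLinearMap
    refine LinearIndependent.of_comp ev ?_
    have h : (ev ∘ fun w : {w : List (PathGen n) // w.length = d ∧
        w.IsChain fun g h => ¬g.RightOf h} => (w.1.map fun g => y g.toLetter).prod) =
        (fun w => Finsupp.single w (1 : K)) ∘ fun w => w.1.map PathGen.toLetter := by
      funext w
      have h1 : f (w.1.map fun g => y g.toLetter).prod =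
          ((w.1.map PathGen.toLetter).map (mulLetter K)).prod := by
        rw [map_list_prod, List.map_map, List.map_map]
        congr 1
        exact List.map_congr_left fun g _ => hf g
      change f (w.1.map fun g => y g.toLetter).prod (Finsupp.single [] 1) = _
      rw [h1, prod_mulLetter ((normal_map_toLetter n _).mpr w.2.2)]
      rfl
    rw [h]
    refine LinearIndependent.comp (Finsupp.linearIndependent_single_one K _) _ ?_
    exact (List.map_injective_iff.mpr PathGen.toLetter_injective).comp Subtype.val_injective
  · rw [generators_eq, span_range_pow]
    refine le_antisymm (Submodule.span_le.mpr ?_) (Submodule.span_le.mpr ?_)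
    · rintro _ ⟨w, hw, rfl⟩
      have h1 := prod_mem_map_wordProd y (satisfiesRel_pathU K n) (w.map PathGen.toLetter)
      rw [List.map_map, List.length_map, hw] at h1
      refine (?_ : (normalSpan K d).map (wordProd y) ≤ _) h1
      rw [normalSpan, Submodule.map_span, Submodule.span_le]
      rintro _ ⟨_, ⟨v, ⟨hv, hn⟩, rfl⟩, rfl⟩
      rw [wordProd_single]
      -- Rewriting takes place on the infinite path; a word with a letter that leaves the finite
      -- path has product zero.
      by_cases h : ∀ l ∈ v, l.hi < n
      · obtain ⟨v, rfl⟩ : ∃ v' : List (PathGen n), v'.map PathGen.toLetter = v := by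
          rw [← Set.mem_range, Set.range_list_map]
          exact fun l hl => PathGen.exists_toLetter (h l hl)
        rw [List.map_map]
        exact Submodule.subset_span
          ⟨⟨v, by simpa using hv, (normal_map_toLetter n v).mp hn⟩, rfl⟩
      · push Not at h
        obtain ⟨l, hl, hln⟩ := h
        have h0 : (v.map y).prod = 0 :=
          List.prod_eq_zero (List.mem_map.mpr ⟨l, hl, letterValue_of_le _ hln⟩)
        rw [h0]
        exact zero_mem _
    · rintro _ ⟨w, rfl⟩
      exact Submodule.subset_span ⟨w.1, w.2.1, rfl⟩

end PathAlgebra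

/-! ### The quadratic dual of a partially commutative algebra -/

section Sorted

variable {X : Type*} {r : X → X → Prop}

theorem isChain_iff_pairwise_of_trans (ht : ∀ a b c, r a b → r b c → r a c) {w : List X} :
    w.IsChain r ↔ w.Pairwise r := by
  have : IsTrans X r := ⟨ht⟩
  exact List.isChain_iff_pairwise

/-- Insertion compares only the new letter with the old ones, so a partial order is enough. -/
theorem exists_sorted_cons (ht : ∀ a b c, r a b → r b c → r a c) {a : X} {w : List X}
    (hw : w.Pairwise r) (ha : ∀ b ∈ w, r a b ∨ r b a) :
    ∃ v : List X, v.Perm (a :: w) ∧ v.Pairwise r := by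
  induction w with
  | nil => exact ⟨[a], List.Perm.refl _, List.pairwise_singleton r a⟩
  | cons b w ih =>
    rw [List.pairwise_cons] at hw
    rcases ha b List.mem_cons_self with h | h
    · refine ⟨a :: b :: w, List.Perm.refl _, List.pairwise_cons.mpr ⟨?_, List.pairwise_cons.mpr hw⟩⟩
      intro c hc
      rcases List.mem_cons.mp hc with rfl | hc
      exacts [h, ht _ _ _ h (hw.1 c hc)]
    · obtain ⟨v, hv, hv'⟩ := ih hw.2 fun c hc => ha c (List.mem_cons_of_mem _ hc)
      refine ⟨b :: v, (hv.cons b).trans (List.Perm.swap _ _ _), List.pairwise_cons.mpr ⟨?_, hv'⟩⟩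
      intro c hc
      rcases List.mem_cons.mp (hv.mem_iff.mp hc) with rfl | hc
      exacts [h, hw.1 c hc]

variable [DecidableEq X]

/-- Sorted words have no repetitions, so equal sets make them permutations of each other; asymmetry
then fixes the order. -/
theorem sorted_toFinset_injective (hi : ∀ a, ¬r a a) (ht : ∀ a b c, r a b → r b c → r a c)
    {v w : List X} (hv : v.Pairwise r) (hw : w.Pairwise r) (h : v.toFinset = w.toFinset) :
    v = w := by
  have hn : ∀ {u : List X}, u.Pairwise r → u.Nodup := fun hu =>
    List.Pairwise.imp (S := fun a b => a ≠ b) (fun {a b} hab e => hi a (by rwa [← e] at hab)) hu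
  have hp : v.Perm w := by
    rw [List.perm_ext_iff_of_nodup (hn hv) (hn hw)]
    intro a
    rw [← List.mem_toFinset, h, List.mem_toFinset]
  exact hp.eq_of_pairwise (fun a b _ _ h1 h2 => absurd (ht _ _ _ h1 h2) (hi a)) hv hw

end Sorted

/-! ### Signed insertion into finite sets -/

section ExteriorFace

variable (K : Type*) [Field K] {X : Type*} [DecidableEq X] (r : X → X → Prop) [DecidableRel r]

/-- The left multiplication by a generator on the space with basis the finite sets: adjoin the
element with a sign, if it is comparable with all other elements. -/
def adjoin (a : X) : Module.End K (Finset X →₀ K) :=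
  Finsupp.linearCombination K fun s =>
    if ∀ b ∈ s, r a b ∨ r b a then
      Finsupp.single (insert a s) ((-1) ^ (s.filter fun b => r b a).card) else 0

variable {K r}

theorem adjoin_single (a : X) (s : Finset X) (k : K) :
    adjoin K r a (Finsupp.single s k) = if ∀ b ∈ s, r a b ∨ r b a then
      Finsupp.single (insert a s) (k * (-1) ^ (s.filter fun b => r b a).card) else 0 := by
  rw [adjoin, Finsupp.linearCombination_single]
  split_ifs
  · rw [Finsupp.smul_single, smul_eq_mul]
  · rw [smul_zero]

theorem adjoin_mul_of_not {a b : X} (h : ¬(r a b ∨ r b a)) : adjoin K r a * adjoin K r b = 0 := by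
  refine Finsupp.lhom_ext fun s k => ?_
  rw [Module.End.mul_apply, adjoin_single]
  split_ifs with hs
  · rw [adjoin_single, if_neg fun h' => h (h' b (Finset.mem_insert_self b s)), LinearMap.zero_apply]
  · rw [map_zero, LinearMap.zero_apply]

/-- Both orders of insertion yield the same set. As `a` precedes `b`, only the sign of `b` changes
if the other element is already present. -/
theorem adjoin_anticomm (hi : ∀ a, ¬r a a) (ht : ∀ a b c, r a b → r b c → r a c) {a b : X}
    (h : r a b) : adjoin K r a * adjoin K r b + adjoin K r b * adjoin K r a = 0 := by
  have hba : ¬r b a := fun h' => hi a (ht _ _ _ h h')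
  refine Finsupp.lhom_ext fun s k => ?_
  rw [LinearMap.add_apply, Module.End.mul_apply, Module.End.mul_apply, adjoin_single,
    adjoin_single, LinearMap.zero_apply]
  by_cases ha : ∀ c ∈ s, r a c ∨ r c a
  swap
  · rw [if_neg ha, map_zero, add_zero]
    split_ifs
    · rw [adjoin_single, if_neg fun h' => ha fun c hc => h' c (Finset.mem_insert_of_mem hc)]
    · rw [map_zero]
  by_cases hb : ∀ c ∈ s, r b c ∨ r c b
  swap
  · rw [if_neg hb, map_zero, zero_add, if_pos ha, adjoin_single,
      if_neg fun h' => hb fun c hc => h' c (Finset.mem_insert_of_mem hc)]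
  have ha' : a ∉ s := fun h' => hi a (or_self_iff.mp (ha a h'))
  rw [if_pos ha, if_pos hb, adjoin_single, adjoin_single,
    if_pos ((Finset.forall_mem_insert b s fun c => r a c ∨ r c a).mpr ⟨Or.inl h, ha⟩),
    if_pos ((Finset.forall_mem_insert a s fun c => r b c ∨ r c b).mpr ⟨Or.inr h, hb⟩),
    Finset.filter_insert, Finset.filter_insert, if_neg hba, if_pos h,
    Finset.card_insert_of_notMem fun h' => ha' (Finset.mem_filter.mp h').1,
    Finset.insert_comm b a, ← Finsupp.single_add, pow_succ]
  rw [show ∀ x y : K, k * x * y + k * y * (x * -1) = 0 by intros; ring, Finsupp.single_zero]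

theorem prod_adjoin (hi : ∀ a, ¬r a a) (ht : ∀ a b c, r a b → r b c → r a c) {w : List X}
    (hw : w.Pairwise r) :
    (w.map (adjoin K r)).prod (Finsupp.single ∅ 1) = Finsupp.single w.toFinset 1 := by
  induction w with
  | nil => rfl
  | cons b w ih =>
    rw [List.pairwise_cons] at hw
    have h1 : ∀ c ∈ w.toFinset, r b c ∨ r c b := fun c hc => Or.inl (hw.1 c (List.mem_toFinset.mp hc))
    have h2 : (w.toFinset.filter fun c => r c b) = ∅ := by
      rw [Finset.filter_eq_empty_iff]
      intro c hc h
      exact hi b (ht _ _ _ (hw.1 c (List.mem_toFinset.mp hc)) h)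
    rw [List.map_cons, List.prod_cons, Module.End.mul_apply, ih hw.2, adjoin_single, if_pos h1, h2,
      Finset.card_empty, pow_zero, mul_one, List.toFinset_cons]

end ExteriorFace

/-! ### A basis of the quadratic dual -/

section Dual

variable {K : Type*} [Field K] {X : Type*} {c r : X → X → Prop}

/-- A symmetric functional kills every commutator, whatever `a` and `b` are. -/
theorem tmul_mem_dualRelations_add (a b : X) :
    (Finsupp.lapply a ⊗ₜ Finsupp.lapply b + Finsupp.lapply b ⊗ₜ Finsupp.lapply a :
      Module.Dual K (X →₀ K) ⊗[K] Module.Dual K (X →₀ K)) ∈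
      dualRelations K (commutatorRelations K c) := by
  rw [dualRelations, Submodule.mem_comap, Submodule.mem_dualAnnihilator]
  intro t ht
  refine Submodule.span_induction ?_ (map_zero _) (fun x y _ _ hx hy => ?_)
    (fun k x _ hx => ?_) ht
  · rintro _ ⟨d, e, -, rfl⟩
    simp only [map_add, map_sub, LinearMap.add_apply, TensorProduct.dualDistrib_apply]
    ring
  · rw [map_add, hx, hy, add_zero]
  · rw [map_smul, hx, smul_zero]

/-- The case `a = b` makes the squares vanish in characteristic two as well, where anticommutation
does not. -/
theorem tmul_mem_dualRelations {a b : X} (h : ¬(c a b ∨ c b a)) :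
    (Finsupp.lapply a ⊗ₜ Finsupp.lapply b :
      Module.Dual K (X →₀ K) ⊗[K] Module.Dual K (X →₀ K)) ∈
      dualRelations K (commutatorRelations K c) := by
  classical
  rw [dualRelations, Submodule.mem_comap, Submodule.mem_dualAnnihilator]
  intro t ht
  refine Submodule.span_induction ?_ (map_zero _) (fun x y _ _ hx hy => ?_)
    (fun k x _ hx => ?_) ht
  · rintro _ ⟨d, e, hde, rfl⟩
    have h1 : ¬(d = a ∧ e = b) := by rintro ⟨rfl, rfl⟩; exact h (Or.inl hde)
    have h2 : ¬(e = a ∧ d = b) := by rintro ⟨rfl, rfl⟩; exact h (Or.inr hde)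
    simp only [map_sub, TensorProduct.dualDistrib_apply, Finsupp.lapply_apply,
      Finsupp.single_apply, ← ite_and, mul_ite, mul_one, mul_zero]
    rw [if_neg fun h => h1 ⟨h.2, h.1⟩, if_neg fun h => h2 ⟨h.2, h.1⟩, sub_zero]
  · rw [map_add, hx, hy, add_zero]
  · rw [map_smul, hx, smul_zero]

variable (K c)

/-- The algebra `{V, R}^!` for the commutator relations `R` of the pairs in `c`. -/
abbrev DualAlg : Type _ := QuadAlg K (dualRelations K (commutatorRelations K c))

/-- The generator of the quadratic dual that belongs to an element of the basis. -/
def dualGen (a : X) : DualAlg K c :=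
  RingQuot.mkAlgHom K _ (TensorAlgebra.ι K (Finsupp.lapply a : Module.Dual K (X →₀ K)))

variable {K c}

theorem dualGen_mul_add (a b : X) :
    dualGen K c a * dualGen K c b + dualGen K c b * dualGen K c a = 0 := by
  have h := RingQuot.mkAlgHom_rel K (s := fun x y : TensorAlgebra K (Module.Dual K (X →₀ K)) =>
    (∃ t ∈ dualRelations K (commutatorRelations K c), x = degreeTwo K t) ∧ y = 0)
    ⟨⟨_, tmul_mem_dualRelations_add a b, rfl⟩, rfl⟩
  have e : degreeTwo K (Finsupp.lapply a ⊗ₜ Finsupp.lapply b + Finsupp.lapply b ⊗ₜ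
      Finsupp.lapply a : Module.Dual K (X →₀ K) ⊗[K] Module.Dual K (X →₀ K)) =
      TensorAlgebra.ι K (Finsupp.lapply a) * TensorAlgebra.ι K (Finsupp.lapply b) +
        TensorAlgebra.ι K (Finsupp.lapply b) * TensorAlgebra.ι K (Finsupp.lapply a) := by
    simp [degreeTwo]
  rw [map_zero, e] at h
  exact (((map_add _ _ _).trans (congrArg₂ _ (map_mul _ _ _) (map_mul _ _ _))).symm).trans h

theorem dualGen_mul_swap (a b : X) :
    dualGen K c a * dualGen K c b = (-1 : K) • (dualGen K c b * dualGen K c a) := by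
  have h : ∀ y : DualAlg K c, y + (-1 : K) • y = 0 := fun y => by
    rw [← one_smul K y, smul_smul, ← add_smul, mul_one, add_neg_cancel, zero_smul]
  rw [← add_zero (dualGen K c a * dualGen K c b), ← h (dualGen K c b * dualGen K c a),
    ← add_assoc, dualGen_mul_add, zero_add]

theorem dualGen_mul_of_not {a b : X} (h : ¬(c a b ∨ c b a)) :
    dualGen K c a * dualGen K c b = 0 := by
  have h := RingQuot.mkAlgHom_rel K (s := fun x y : TensorAlgebra K (Module.Dual K (X →₀ K)) =>
    (∃ t ∈ dualRelations K (commutatorRelations K c), x = degreeTwo K t) ∧ y = 0)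
    ⟨⟨_, tmul_mem_dualRelations h, rfl⟩, rfl⟩
  have e : degreeTwo K (Finsupp.lapply a ⊗ₜ Finsupp.lapply b :
      Module.Dual K (X →₀ K) ⊗[K] Module.Dual K (X →₀ K)) =
      TensorAlgebra.ι K (Finsupp.lapply a) * TensorAlgebra.ι K (Finsupp.lapply b) := by
    simp [degreeTwo]
  rw [map_zero, e] at h
  exact (map_mul _ _ _).symm.trans h

theorem dual_eq_sum [Fintype X] (φ : Module.Dual K (X →₀ K)) :
    φ = ∑ a, φ (Finsupp.single a 1) • (Finsupp.lapply a : Module.Dual K (X →₀ K)) := by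
  classical
  refine Finsupp.lhom_ext' fun b => LinearMap.ext_ring ?_
  simp [Finsupp.single_apply]

theorem dual_generators_eq [Fintype X] :
    QuadAlg.generators K (dualRelations K (commutatorRelations K c)) =
      Submodule.span K (Set.range (dualGen K c)) := by
  refine le_antisymm ?_ (Submodule.span_le.mpr ?_)
  · rintro _ ⟨_, ⟨φ, rfl⟩, rfl⟩
    rw [dual_eq_sum φ, map_sum, map_sum]
    refine sum_mem fun a _ => ?_
    rw [map_smul, map_smul]
    exact Submodule.smul_mem _ _ (Submodule.subset_span ⟨a, rfl⟩)
  · rintro _ ⟨a, rfl⟩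
    exact ⟨_, ⟨_, rfl⟩, rfl⟩

/-- The product of the generators of a word is up to a sign the product of a sorted word. -/
theorem dualGen_mul_sorted (hc : ∀ a b, c a b ∨ c b a ↔ r a b ∨ r b a)
    (ht : ∀ a b c, r a b → r b c → r a c) (a : X) {w : List X} (hw : w.Pairwise r) :
    dualGen K c a * (w.map (dualGen K c)).prod = 0 ∨
      ∃ v : List X, v.Perm (a :: w) ∧ v.Pairwise r ∧ ∃ k : K,
        dualGen K c a * (w.map (dualGen K c)).prod = k • (v.map (dualGen K c)).prod := by
  induction w with
  | nil => exact Or.inr ⟨[a], List.Perm.refl _, List.pairwise_singleton r a, 1, by simp⟩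
  | cons b w ih =>
    rw [List.pairwise_cons] at hw
    rw [List.map_cons, List.prod_cons, ← mul_assoc]
    by_cases hab : r a b ∨ r b a
    swap
    · left
      rw [dualGen_mul_of_not (fun h => hab ((hc a b).mp h)), zero_mul]
    rcases hab with h | h
    · refine Or.inr ⟨a :: b :: w, List.Perm.refl _,
        List.pairwise_cons.mpr ⟨?_, List.pairwise_cons.mpr hw⟩, 1, by simp [mul_assoc]⟩
      intro c hc
      rcases List.mem_cons.mp hc with rfl | hc
      exacts [h, ht _ _ _ h (hw.1 c hc)]
    · rw [dualGen_mul_swap a b, smul_mul_assoc, mul_assoc]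
      rcases ih hw.2 with h0 | ⟨v, hv, hv', k, hk⟩
      · left
        rw [h0, mul_zero, smul_zero]
      · refine Or.inr ⟨b :: v, (hv.cons b).trans (List.Perm.swap _ _ _),
          List.pairwise_cons.mpr ⟨?_, hv'⟩, -1 * k, ?_⟩
        · intro c hc
          rcases List.mem_cons.mp (hv.mem_iff.mp hc) with rfl | hc
          exacts [h, hw.1 c hc]
        · rw [hk, mul_smul_comm, smul_smul, List.map_cons, List.prod_cons]

theorem prod_dualGen_mem (hc : ∀ a b, c a b ∨ c b a ↔ r a b ∨ r b a)
    (ht : ∀ a b c, r a b → r b c → r a c) (w : List X) :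
    (w.map (dualGen K c)).prod ∈ Submodule.span K (Set.range
      fun v : {v : List X // v.length = w.length ∧ v.IsChain r} =>
        (v.1.map (dualGen K c)).prod) := by
  induction w with
  | nil => exact Submodule.subset_span ⟨⟨[], rfl, List.isChain_nil⟩, rfl⟩
  | cons a w ih =>
    rw [List.map_cons, List.prod_cons]
    refine Submodule.span_induction (p := fun x _ => dualGen K c a * x ∈ _) ?_ ?_ ?_ ?_ ih
    · rintro _ ⟨⟨v, hv, hv'⟩, rfl⟩
      rcases dualGen_mul_sorted (K := K) hc ht a ((isChain_iff_pairwise_of_trans ht).mp hv') with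
        h | ⟨u, hu, hu', k, hk⟩
      · simp only [h]
        exact zero_mem _
      · simp only [hk]
        refine Submodule.smul_mem _ _ (Submodule.subset_span ⟨⟨u, ?_, ?_⟩, rfl⟩)
        · rw [hu.length_eq, List.length_cons, List.length_cons, hv]
        · exact (isChain_iff_pairwise_of_trans ht).mpr hu'
    · rw [mul_zero]
      exact zero_mem _
    · intro x y _ _ hx hy
      rw [mul_add]
      exact add_mem hx hy
    · intro k x _ hx
      rw [mul_smul_comm]
      exact Submodule.smul_mem _ _ hx

/-- The homomorphism from the quadratic dual given by elements that satisfy its relations. -/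
theorem exists_dual_lift [Fintype X] {B : Type*} [Ring B] [Algebra K B] {x : X → B}
    (h1 : ∀ a b, c a b → x a * x b + x b * x a = 0)
    (h2 : ∀ a b, ¬(c a b ∨ c b a) → x a * x b = 0) (h3 : ∀ a, x a * x a = 0) :
    ∃ f : DualAlg K c →ₐ[K] B, ∀ a, f (dualGen K c a) = x a := by
  classical
  let L : Module.Dual K (X →₀ K) →ₗ[K] B :=
    ∑ a, (LinearMap.applyₗ (R := K) (M₂ := K) (Finsupp.single a (1 : K))).smulRight (x a)
  have hL : ∀ φ, L φ = ∑ a, φ (Finsupp.single a 1) • x a := fun φ => by simp [L]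
  let g := TensorAlgebra.lift K L
  have hg : ∀ t, g (degreeTwo K t) = ∑ p : X × X, TensorProduct.dualDistrib K (X →₀ K) (X →₀ K) t
      (Finsupp.single p.1 1 ⊗ₜ Finsupp.single p.2 1) • (x p.1 * x p.2) := by
    intro t
    induction t with
    | zero => simp
    | add s t hs ht => simp only [map_add, hs, ht, LinearMap.add_apply, add_smul,
        Finset.sum_add_distrib]
    | tmul φ ψ =>
      simp only [degreeTwo, LinearMap.comp_apply, TensorProduct.map_tmul, LinearMap.mul'_apply,
        map_mul, g, TensorAlgebra.lift_ι_apply, hL, Finset.sum_mul_sum, Fintype.sum_prod_type,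
        TensorProduct.dualDistrib_apply, smul_mul_smul_comm]
  have hrel : ∀ t ∈ dualRelations K (commutatorRelations K c), g (degreeTwo K t) = 0 := by
    intro t ht
    rw [hg]
    have hsymm : ∀ a b, c a b → TensorProduct.dualDistrib K (X →₀ K) (X →₀ K) t
        (Finsupp.single a 1 ⊗ₜ Finsupp.single b 1) =
        TensorProduct.dualDistrib K (X →₀ K) (X →₀ K) t
          (Finsupp.single b 1 ⊗ₜ Finsupp.single a 1) := by
      intro a b hab
      rw [dualRelations, Submodule.mem_comap, Submodule.mem_dualAnnihilator] at ht
      have := ht _ (Submodule.subset_span ⟨a, b, hab, rfl⟩)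
      rwa [map_sub, sub_eq_zero] at this
    -- The terms of (a, b) and (b, a) cancel: for a relation the coefficients agree and the products
    -- anticommute, otherwise both products vanish. The diagonal is settled by `h3`.
    refine Finset.sum_involution (fun p _ => p.swap) ?_ ?_ (fun _ _ => Finset.mem_univ _)
      fun p _ => Prod.swap_swap p
    · rintro ⟨a, b⟩ -
      by_cases hab : c a b
      · simp only [Prod.fst_swap, Prod.snd_swap]
        rw [← hsymm a b hab, ← smul_add, h1 a b hab, smul_zero]
      · by_cases hba : c b a
        · simp only [Prod.fst_swap, Prod.snd_swap]
          rw [← hsymm b a hba, ← smul_add, add_comm, h1 b a hba, smul_zero]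
        · simp only [Prod.fst_swap, Prod.snd_swap]
          rw [h2 a b (by tauto), h2 b a (by tauto), smul_zero, smul_zero, add_zero]
    · rintro ⟨a, b⟩ - h e
      obtain rfl : b = a := congrArg Prod.fst e
      exact h (by simp only [h3, smul_zero])
  refine ⟨RingQuot.liftAlgHom K ⟨g, ?_⟩, fun a => ?_⟩
  · rintro _ _ ⟨⟨t, ht, rfl⟩, rfl⟩
    rw [hrel t ht, map_zero]
  · rw [dualGen, RingQuot.liftAlgHom_mkAlgHom_apply, TensorAlgebra.lift_ι_apply, hL]
    simp [Finsupp.single_apply]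

/-- The sorted words of length `d` form a basis of the component of degree `d` of the quadratic
dual. -/
theorem finrank_dual_generators_pow [Finite X] (hc : ∀ a b, c a b ∨ c b a ↔ r a b ∨ r b a)
    (hi : ∀ a, ¬r a a) (ht : ∀ a b c, r a b → r b c → r a c) (d : ℕ) :
    Module.finrank K (QuadAlg.generators K (dualRelations K (commutatorRelations K c)) ^ d :
      Submodule K _) = chainCount r d := by
  classical
  have := Fintype.ofFinite X
  have := finite_words (X := X) d fun w => w.IsChain r
  refine finrank_eq_natCard (K := K) (ι := {w : List X // w.length = d ∧ w.IsChain r})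
    (f := fun w => (w.1.map (dualGen K c)).prod) ?_ ?_
  · have hii : ∀ a, adjoin K r a * adjoin K r a = 0 := fun a =>
      adjoin_mul_of_not fun h => hi a (or_self_iff.mp h)
    obtain ⟨f, hf⟩ := exists_dual_lift (K := K) (c := c) (x := adjoin K r)
      (fun a b hab => by
        rcases (hc a b).mp (Or.inl hab) with h | h
        · exact adjoin_anticomm hi ht h
        · rw [add_comm]
          exact adjoin_anticomm hi ht h)
      (fun a b hab => adjoin_mul_of_not fun h => hab ((hc a b).mpr h)) hii
    let ev : DualAlg K c →ₗ[K] (Finset X →₀ K) :=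
      LinearMap.applyₗ (R := K) (M₂ := Finset X →₀ K) (Finsupp.single ∅ (1 : K)) ∘ₗ
        f.toLinearMap
    refine LinearIndependent.of_comp ev ?_
    have h : (ev ∘ fun w : {w : List X // w.length = d ∧ w.IsChain r} =>
        (w.1.map (dualGen K c)).prod) =
        (fun s => Finsupp.single s (1 : K)) ∘ fun w => w.1.toFinset := by
      funext w
      have h1 : f (w.1.map (dualGen K c)).prod = (w.1.map (adjoin K r)).prod := by
        rw [map_list_prod, List.map_map]
        congr 1
        exact List.map_congr_left fun a _ => hf a
      change f (w.1.map (dualGen K c)).prod (Finsupp.single ∅ 1) = _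
      rw [h1, prod_adjoin hi ht ((isChain_iff_pairwise_of_trans ht).mp w.2.2)]
      rfl
    rw [h]
    refine LinearIndependent.comp (Finsupp.linearIndependent_single_one K _) _ ?_
    rintro ⟨v, hv₁, hv⟩ ⟨w, hw₁, hw⟩ hvw
    exact Subtype.ext (sorted_toFinset_injective hi ht
      ((isChain_iff_pairwise_of_trans ht).mp hv) ((isChain_iff_pairwise_of_trans ht).mp hw) hvw)
  · rw [dual_generators_eq, span_range_pow]
    refine le_antisymm (Submodule.span_le.mpr ?_) (Submodule.span_le.mpr ?_)
    · rintro _ ⟨w, rfl, rfl⟩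
      exact prod_dualGen_mem hc ht w
    · rintro _ ⟨w, rfl⟩
      exact Submodule.subset_span ⟨w.1, w.2.1, rfl⟩

end Dual

/-! ### Cliques and matchings -/

section Cliques

variable {X : Type*} {r : X → X → Prop}

theorem comparable_of_pairwise {w : List X} (hw : w.Pairwise r) {a b : X} (ha : a ∈ w)
    (hb : b ∈ w) (hab : a ≠ b) : r a b ∨ r b a := by
  induction w with
  | nil => simp at ha
  | cons c w ih =>
    rw [List.pairwise_cons] at hw
    rcases List.mem_cons.mp ha with rfl | ha' <;> rcases List.mem_cons.mp hb with rfl | hb'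
    · exact absurd rfl hab
    · exact Or.inl (hw.1 b hb')
    · exact Or.inr (hw.1 a ha')
    · exact ih hw.2 ha' hb'

variable [DecidableEq X]

theorem exists_sorted_toFinset (ht : ∀ a b c, r a b → r b c → r a c) (s : Finset X)
    (hs : ∀ a ∈ s, ∀ b ∈ s, a ≠ b → r a b ∨ r b a) :
    ∃ w : List X, w.Pairwise r ∧ w.length = s.card ∧ w.toFinset = s := by
  induction s using Finset.induction_on with
  | empty => exact ⟨[], List.Pairwise.nil, rfl, rfl⟩
  | insert a s ha ih =>
    obtain ⟨w, hw, hl, rfl⟩ := ih fun b hb c hc =>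
      hs b (Finset.mem_insert_of_mem hb) c (Finset.mem_insert_of_mem hc)
    obtain ⟨v, hv, hv'⟩ := exists_sorted_cons ht (a := a) hw fun b hb =>
      hs a (Finset.mem_insert_self _ _) b
        (Finset.mem_insert_of_mem (List.mem_toFinset.mpr hb))
        (by rintro rfl; exact ha (List.mem_toFinset.mpr hb))
    refine ⟨v, hv', ?_, ?_⟩
    · rw [hv.length_eq, List.length_cons, hl, Finset.card_insert_of_notMem ha]
    · rw [List.toFinset_eq_of_perm _ _ hv, List.toFinset_cons]

/-- The chains of a strict order are counted by the finite sets of comparable elements. -/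
theorem chainCount_eq_card (hi : ∀ a, ¬r a a) (ht : ∀ a b c, r a b → r b c → r a c) (d : ℕ) :
    chainCount r d =
      Nat.card {s : Finset X // s.card = d ∧ ∀ a ∈ s, ∀ b ∈ s, a ≠ b → r a b ∨ r b a} := by
  have hn : ∀ {w : List X}, w.IsChain r → w.Pairwise r := fun h =>
    (isChain_iff_pairwise_of_trans ht).mp h
  refine Nat.card_congr (Equiv.ofBijective (fun w => ⟨w.1.toFinset, ?_, ?_⟩) ⟨?_, ?_⟩)
  · rw [List.toFinset_card_of_nodup, w.2.1]
    exact List.Pairwise.imp (S := fun a b => a ≠ b)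
      (fun {a b} hab e => hi a (by rwa [← e] at hab)) (hn w.2.2)
  · intro a ha b hb hab
    exact comparable_of_pairwise (hn w.2.2) (List.mem_toFinset.mp ha) (List.mem_toFinset.mp hb) hab
  · rintro ⟨v, hv₁, hv⟩ ⟨w, hw₁, hw⟩ h
    exact Subtype.ext (sorted_toFinset_injective hi ht (hn hv) (hn hw) (congrArg Subtype.val h))
  · rintro ⟨s, rfl, hs⟩
    obtain ⟨w, hw, hl, h⟩ := exists_sorted_toFinset ht s hs
    exact ⟨⟨w, hl, (isChain_iff_pairwise_of_trans ht).mpr hw⟩, Subtype.ext h⟩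

end Cliques

section Generators

variable {n : ℕ}

/-- A set of edges of the path no two of which have a common vertex. -/
def Sparse (E : Finset (Fin (n - 1))) : Prop :=
  ∀ a ∈ E, ∀ b ∈ E, (a : ℕ) < b → (a : ℕ) + 1 < b

/-- The vertices that a set of edges covers. -/
def covered (E : Finset (Fin (n - 1))) : Finset (Fin n) :=
  Finset.univ.filter fun i => ∃ a ∈ E, (i : ℕ) = a ∨ (i : ℕ) = a + 1

theorem mem_covered {E : Finset (Fin (n - 1))} {i : Fin n} :
    i ∈ covered E ↔ ∃ a ∈ E, (i : ℕ) = a ∨ (i : ℕ) = a + 1 := by simp [covered]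

theorem card_covered {E : Finset (Fin (n - 1))} (hE : Sparse E) :
    (covered E).card = 2 * E.card := by
  have h : covered E = E.biUnion fun a => {⟨a, by omega⟩, ⟨a + 1, by omega⟩} := by
    ext i
    simp only [mem_covered, Finset.mem_biUnion, Finset.mem_insert, Finset.mem_singleton,
      Fin.ext_iff]
  rw [h, Finset.card_biUnion, Finset.sum_const_nat (m := 2), mul_comm]
  · intro a _
    exact Finset.card_pair (by simp)
  · intro a ha b hb hab
    have h1 := hE a ha b hb
    have h2 := hE b hb a ha
    have h3 : (a : ℕ) ≠ b := fun h => hab (Fin.ext h)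
    rw [Function.onFun, Finset.disjoint_left]
    intro i hi hi'
    simp only [Finset.mem_insert, Finset.mem_singleton, Fin.ext_iff] at hi hi'
    omega

/-- Any two distinct elements of the set lie to the left and to the right of each other. -/
def Clique (s : Finset (PathGen n)) : Prop :=
  ∀ a ∈ s, ∀ b ∈ s, a ≠ b → a.RightOf b ∨ b.RightOf a

open Classical in
/-- The set of generators given by a set of edges and a set of vertices. -/
def joinGens (E : Finset (Fin (n - 1))) (W : Finset (Fin n)) : Finset (PathGen n) :=
  W.image PathGen.vertex ∪ E.image PathGen.edge

theorem vertex_mem_joinGens {E : Finset (Fin (n - 1))} {W : Finset (Fin n)} {i : Fin n} :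
    PathGen.vertex i ∈ joinGens E W ↔ i ∈ W := by simp [joinGens]

theorem edge_mem_joinGens {E : Finset (Fin (n - 1))} {W : Finset (Fin n)} {i : Fin (n - 1)} :
    PathGen.edge i ∈ joinGens E W ↔ i ∈ E := by simp [joinGens]

theorem card_joinGens (E : Finset (Fin (n - 1))) (W : Finset (Fin n)) :
    (joinGens E W).card = W.card + E.card := by
  classical
  rw [joinGens, Finset.card_union_of_disjoint, Finset.card_image_of_injective,
    Finset.card_image_of_injective]
  · exact fun a b h => PathGen.edge.inj h
  · exact fun a b h => PathGen.vertex.inj h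
  · rw [Finset.disjoint_left]
    simp

theorem clique_joinGens {E : Finset (Fin (n - 1))} {W : Finset (Fin n)} :
    Clique (joinGens E W) ↔ Sparse E ∧ W ⊆ (covered E)ᶜ := by
  constructor
  · intro h
    refine ⟨fun a ha b hb hab => ?_, fun i hi => ?_⟩
    · have := h (.edge a) (edge_mem_joinGens.mpr ha) (.edge b) (edge_mem_joinGens.mpr hb)
        (by simp [Fin.ext_iff]; omega)
      simp only [PathGen.RightOf, RightOf, PathGen.toLetter, hi_edge] at this
      omega
    · rw [Finset.mem_compl, mem_covered]
      rintro ⟨a, ha, hia⟩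
      have := h (.vertex i) (vertex_mem_joinGens.mpr hi) (.edge a) (edge_mem_joinGens.mpr ha)
        (by simp)
      simp only [PathGen.RightOf, RightOf, PathGen.toLetter, hi_edge, hi_vertex] at this
      omega
  · rintro ⟨hE, hW⟩ g hg h hh hgh
    have hWE : ∀ i ∈ W, ∀ a ∈ E, (i : ℕ) ≠ a ∧ (i : ℕ) ≠ a + 1 := fun i hi a ha => by
      have := hW hi
      rw [Finset.mem_compl, mem_covered] at this
      exact ⟨fun h => this ⟨a, ha, Or.inl h⟩, fun h => this ⟨a, ha, Or.inr h⟩⟩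
    rcases g with i | a <;> rcases h with j | b <;>
      simp only [vertex_mem_joinGens, edge_mem_joinGens] at hg hh <;>
      simp only [PathGen.RightOf, RightOf, PathGen.toLetter, hi_edge, hi_vertex]
    · have : (i : ℕ) ≠ j := fun h => hgh (by rw [Fin.ext h])
      omega
    · have := hWE i hg b hh
      omega
    · have := hWE j hh a hg
      omega
    · have h1 := hE a hg b hh
      have h2 := hE b hh a hg
      have : (a : ℕ) ≠ b := fun h => hgh (by rw [Fin.ext h])
      omega

theorem joinGens_surjective (s : Finset (PathGen n)) :
    ∃ E W, joinGens E W = s := by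
  classical
  refine ⟨Finset.univ.filter fun a => .edge a ∈ s, Finset.univ.filter fun i => .vertex i ∈ s, ?_⟩
  ext g
  rcases g with i | a
  · simp [vertex_mem_joinGens]
  · simp [edge_mem_joinGens]

theorem joinGens_inj {E E' : Finset (Fin (n - 1))} {W W' : Finset (Fin n)}
    (h : joinGens E W = joinGens E' W') : E = E' ∧ W = W' := by
  constructor
  · ext a
    rw [← edge_mem_joinGens (W := W), h, edge_mem_joinGens]
  · ext i
    rw [← vertex_mem_joinGens (E := E), h, vertex_mem_joinGens]

/-- The cliques with `d` elements. -/
theorem card_clique (n d : ℕ) :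
    Nat.card {s : Finset (PathGen n) // s.card = d ∧ Clique s} =
      ∑ j ∈ Finset.range (d + 1),
        Nat.card {E : Finset (Fin (n - 1)) // Sparse E ∧ E.card = j} *
          (n - 2 * j).choose (d - j) := by
  classical
  -- The bound on the number of edges keeps `d - E.card` from being truncated.
  let S : Finset (Finset (Fin (n - 1))) :=
    Finset.univ.filter fun E => Sparse E ∧ E.card < d + 1
  have h1 : Nat.card {s : Finset (PathGen n) // s.card = d ∧ Clique s} =
      (S.sigma fun E => Finset.powersetCard (d - E.card) (covered E)ᶜ).card := by
    rw [Nat.card_eq_fintype_card, Fintype.card_subtype]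
    symm
    refine Finset.card_bij (fun p _ => joinGens p.1 p.2) ?_ ?_ ?_
    · rintro ⟨E, W⟩ h
      simp only [S, Finset.mem_sigma, Finset.mem_filter, Finset.mem_univ, true_and,
        Finset.mem_powersetCard] at h
      rw [Finset.mem_filter, card_joinGens, clique_joinGens]
      refine ⟨Finset.mem_univ _, ?_, h.1.1, h.2.1⟩
      have := h.1.2
      have := h.2.2
      simp only
      omega
    · rintro ⟨E, W⟩ - ⟨E', W'⟩ - h
      obtain ⟨rfl, rfl⟩ := joinGens_inj h
      rfl
    · intro s hs
      obtain ⟨E, W, rfl⟩ := joinGens_surjective s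
      rw [Finset.mem_filter, card_joinGens, clique_joinGens] at hs
      refine ⟨⟨E, W⟩, ?_, rfl⟩
      simp only [S, Finset.mem_sigma, Finset.mem_filter, Finset.mem_univ, true_and,
        Finset.mem_powersetCard]
      exact ⟨⟨hs.2.2.1, by omega⟩, hs.2.2.2, by omega⟩
  have h2 : ∀ E ∈ S, E.card ∈ Finset.range (d + 1) := fun E hE =>
    Finset.mem_range.mpr (Finset.mem_filter.mp hE).2.2
  rw [h1, Finset.card_sigma, ← Finset.sum_fiberwise_of_maps_to h2]
  refine Finset.sum_congr rfl fun j hj => ?_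
  rw [Nat.card_eq_fintype_card, Fintype.card_subtype]
  have h3 : (S.filter fun E => E.card = j) =
      Finset.univ.filter fun E : Finset (Fin (n - 1)) => Sparse E ∧ E.card = j := by
    ext E
    have := Finset.mem_range.mp hj
    simp only [S, Finset.mem_filter, Finset.mem_univ, true_and]
    constructor
    · rintro ⟨⟨h, -⟩, h'⟩
      exact ⟨h, h'⟩
    · rintro ⟨h, h'⟩
      exact ⟨⟨h, by omega⟩, h'⟩
  rw [h3]
  refine Finset.sum_const_nat fun E hE => ?_
  obtain ⟨-, hs, rfl⟩ := Finset.mem_filter.mp hE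
  -- A sparse set of j edges covers 2j nodes, so `n - 2 * j` is a true difference whenever such a
  -- set exists; otherwise the term is zero.
  rw [Finset.card_powersetCard, Finset.card_compl, card_covered hs, Fintype.card_fin]

/-! ### Matchings as sparse sets of edges -/

section Matchings

open Classical in
/-- The edges of a subgraph of the path, numbered by their left ends. -/
def edgesOf (M : (SimpleGraph.pathGraph n).Subgraph) : Finset (Fin (n - 1)) :=
  Finset.univ.filter fun a => M.Adj ⟨a, by omega⟩ ⟨a + 1, by omega⟩

theorem mem_edgesOf {M : (SimpleGraph.pathGraph n).Subgraph} {a : Fin (n - 1)} :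
    a ∈ edgesOf M ↔ M.Adj ⟨a, by omega⟩ ⟨a + 1, by omega⟩ := by simp [edgesOf]

theorem adj_iff_edgesOf {M : (SimpleGraph.pathGraph n).Subgraph} {i j : Fin n} :
    M.Adj i j ↔ ∃ a ∈ edgesOf M,
      ((i : ℕ) = a ∧ (j : ℕ) = a + 1) ∨ ((i : ℕ) = a + 1 ∧ (j : ℕ) = a) := by
  constructor
  · intro h
    rcases SimpleGraph.pathGraph_adj.mp h.adj_sub with h' | h'
    · refine ⟨⟨i, by omega⟩, mem_edgesOf.mpr ?_, Or.inl ⟨rfl, h'.symm⟩⟩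
      convert h
    · refine ⟨⟨j, by omega⟩, mem_edgesOf.mpr ?_, Or.inr ⟨h'.symm, rfl⟩⟩
      convert h.symm
  · rintro ⟨a, ha, ⟨h1, h2⟩ | ⟨h1, h2⟩⟩ <;> rw [mem_edgesOf] at ha
    · convert ha
    · convert ha.symm

theorem ncard_edgeSet (M : (SimpleGraph.pathGraph n).Subgraph) :
    M.edgeSet.ncard = (edgesOf M).card := by
  let f : Fin (n - 1) → Sym2 (Fin n) := fun a => s(⟨a, by omega⟩, ⟨a + 1, by omega⟩)
  have hf : Function.Injective f := by
    intro a b h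
    rcases Sym2.eq_iff.mp h with h | h <;> simp only [Fin.mk.injEq] at h <;> apply Fin.ext <;> omega
  have h : M.edgeSet = f '' (edgesOf M : Set (Fin (n - 1))) := by
    ext e
    induction e with
    | _ i j =>
      rw [SimpleGraph.Subgraph.mem_edgeSet, adj_iff_edgesOf]
      refine exists_congr fun a => and_congr_right fun _ => ?_
      simp only [f, Sym2.eq_iff, Fin.ext_iff]
      omega
  rw [h, Set.ncard_image_of_injective _ hf, Set.ncard_coe_finset]

/-- The subgraph that consists of a set of edges. -/
def edgeSubgraph (E : Finset (Fin (n - 1))) : (SimpleGraph.pathGraph n).Subgraph where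
  verts := {i | i ∈ covered E}
  Adj i j := ∃ a ∈ E, ((i : ℕ) = a ∧ (j : ℕ) = a + 1) ∨ ((i : ℕ) = a + 1 ∧ (j : ℕ) = a)
  adj_sub := by
    rintro i j ⟨a, -, h⟩
    rw [SimpleGraph.pathGraph_adj]
    omega
  edge_vert := by
    rintro i j ⟨a, ha, h⟩
    exact mem_covered.mpr ⟨a, ha, by omega⟩
  symm := ⟨by
    rintro i j ⟨a, ha, h⟩
    exact ⟨a, ha, by omega⟩⟩

theorem edgesOf_edgeSubgraph (E : Finset (Fin (n - 1))) : edgesOf (edgeSubgraph E) = E := by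
  ext a
  rw [mem_edgesOf]
  constructor
  · rintro ⟨b, hb, h⟩
    obtain rfl : a = b := Fin.ext (by simp only at h; omega)
    exact hb
  · exact fun ha => ⟨a, ha, Or.inl ⟨rfl, rfl⟩⟩

theorem sparse_edgesOf {M : (SimpleGraph.pathGraph n).Subgraph} (hM : M.IsMatching) :
    Sparse (edgesOf M) := by
  intro a ha b hb hab
  rw [mem_edgesOf] at ha hb
  by_contra h
  have e : (⟨b, by omega⟩ : Fin n) = ⟨a + 1, by omega⟩ := Fin.ext (by simp only; omega)
  rw [e] at hb
  have h1 := (hM (M.edge_vert hb)).unique hb ha.symm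
  rw [Fin.ext_iff] at h1
  simp only at h1
  omega

theorem isMatching_edgeSubgraph {E : Finset (Fin (n - 1))} (hE : Sparse E) :
    (edgeSubgraph E).IsMatching := by
  intro i hi
  obtain ⟨a, ha, h⟩ := mem_covered.mp hi
  have key : ∀ b ∈ E, ((i : ℕ) = b ∨ (i : ℕ) = b + 1) → (b : ℕ) = a := by
    intro b hb hib
    have h1 := hE a ha b hb
    have h2 := hE b hb a ha
    omega
  rcases h with h | h
  · refine ⟨⟨a + 1, by omega⟩, ⟨a, ha, Or.inl ⟨h, rfl⟩⟩, ?_⟩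
    rintro j ⟨b, hb, hj⟩
    have := key b hb (by omega)
    exact Fin.ext (by simp only; omega)
  · refine ⟨⟨a, by omega⟩, ⟨a, ha, Or.inr ⟨h, rfl⟩⟩, ?_⟩
    rintro j ⟨b, hb, hj⟩
    have := key b hb (by omega)
    exact Fin.ext (by simp only; omega)

/-- The matchings of the path are the sets of edges without common vertices. -/
theorem pathMatchings_eq (n j : ℕ) :
    pathMatchings n j = Nat.card {E : Finset (Fin (n - 1)) // Sparse E ∧ E.card = j} := by
  rw [pathMatchings, ← Nat.card_coe_set_eq]
  refine Nat.card_congr (Equiv.ofBijective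
    (fun M => ⟨edgesOf M.1, sparse_edgesOf M.2.1, by rw [← ncard_edgeSet]; exact M.2.2⟩) ⟨?_, ?_⟩)
  · rintro ⟨M, hM, hM₁⟩ ⟨N, hN, hN₁⟩ h
    have h' : edgesOf M = edgesOf N := congrArg Subtype.val h
    have hadj : ∀ i j, M.Adj i j ↔ N.Adj i j := fun i j => by
      rw [adj_iff_edgesOf, h', adj_iff_edgesOf]
    -- Every vertex of a matching lies on an edge, so adjacency alone determines the subgraph.
    have hverts : ∀ {L : (SimpleGraph.pathGraph n).Subgraph}, L.IsMatching →
        ∀ i, i ∈ L.verts ↔ ∃ j, L.Adj i j := fun hL i =>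
      ⟨fun hi => (hL hi).exists, fun ⟨j, hj⟩ => SimpleGraph.Subgraph.edge_vert _ hj⟩
    refine Subtype.ext (SimpleGraph.Subgraph.ext ?_ ?_)
    · ext i
      rw [hverts hM, hverts hN]
      exact exists_congr (hadj i)
    · ext i j
      exact hadj i j
  · rintro ⟨E, hE, rfl⟩
    refine ⟨⟨edgeSubgraph E, isMatching_edgeSubgraph hE, ?_⟩,
      Subtype.ext (edgesOf_edgeSubgraph E)⟩
    rw [ncard_edgeSet, edgesOf_edgeSubgraph]

end Matchings

end Generators

/-! ### The theorem -/

section Main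

variable {n : ℕ}

theorem rightOf_irrefl (g : PathGen n) : ¬g.RightOf g := fun h =>
  absurd (h : g.toLetter.hi < g.toLetter.1) (Letter.le_hi _).not_gt

theorem rightOf_trans (g h k : PathGen n) (hgh : g.RightOf h) (hhk : h.RightOf k) :
    g.RightOf k := RightOf.trans hgh hhk

/-- The pairs in `ChopPair` are the disjoint ones, and of two disjoint letters of a path one lies to
the right of the other. -/
theorem chopPair_iff (g h : PathGen n) :
    ChopPair n g h ∨ ChopPair n h g ↔ g.RightOf h ∨ h.RightOf g := by
  constructor
  · rintro (⟨i, j, h⟩ | ⟨i, j, h⟩ | ⟨i, j, h⟩ | ⟨i, j, h⟩ | ⟨i, j, h⟩ | ⟨i, j, h⟩) <;>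
      simp only [PathGen.RightOf, RightOf, PathGen.toLetter, hi_edge, hi_vertex] <;> omega
  · rcases g with i | i <;> rcases h with j | j <;>
      simp only [PathGen.RightOf, RightOf, PathGen.toLetter, hi_edge, hi_vertex]
    · rintro (h | h)
      exacts [Or.inr (.vertex_vertex j i h), Or.inl (.vertex_vertex i j h)]
    · exact fun h => Or.inl (.vertex_edge i j (by omega))
    · exact fun h => Or.inr (.vertex_edge j i (by omega))
    · rintro (h | h)
      exacts [Or.inr (.edge_edge j i h), Or.inl (.edge_edge i j h)]

variable (K : Type*) [Field K]

theorem coeff_chDualHilbert (n d : ℕ) : PowerSeries.coeff d (chDualHilbert K n) =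
    chainCount (PathGen.RightOf (n := n)) d := by
  rw [chDualHilbert, hilbertSeries, PowerSeries.coeff_mk, chRelations,
    finrank_dual_generators_pow chopPair_iff rightOf_irrefl rightOf_trans]

theorem coeff_pathHilbert (n d : ℕ) : PowerSeries.coeff d (pathHilbert K n) =
    chainCount (fun g h : PathGen n => ¬g.RightOf h) d := by
  rw [pathHilbert, hilbertSeries, PowerSeries.coeff_mk, finrank_generators_pow]

/-- Both series count chains, for complementary relations, and the substitution of -x supplies the
signs of `sum_chainCount`. -/
theorem pathHilbert_mul (n : ℕ) :
    pathHilbert K n * PowerSeries.evalNegHom (chDualHilbert K n) = 1 := by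
  classical
  ext d
  rw [mul_comm, PowerSeries.coeff_mul, Finset.Nat.sum_antidiagonal_eq_sum_range_succ_mk]
  simp only [PowerSeries.evalNegHom, PowerSeries.coeff_rescale, coeff_chDualHilbert,
    coeff_pathHilbert, mul_assoc]
  cases d with
  | zero => simp [chainCount_zero]
  | succ d => rw [sum_chainCount, PowerSeries.coeff_one, if_neg d.succ_ne_zero]

theorem coeff_chDualHilbert_eq_sum (n d : ℕ) : PowerSeries.coeff d (chDualHilbert K n) =
    ∑ j ∈ Finset.range (d + 1), (pathMatchings n j : ℤ) * ((n - 2 * j).choose (d - j) : ℤ) := by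
  classical
  have h : chainCount (PathGen.RightOf (n := n)) d =
      Nat.card {s : Finset (PathGen n) // s.card = d ∧ Clique s} :=
    chainCount_eq_card rightOf_irrefl rightOf_trans d
  rw [coeff_chDualHilbert, h, card_clique]
  simp only [pathMatchings_eq]
  push_cast
  rfl

end Main

end PathKoszul

end

theorem mainTheorem7 (K : Type*) [Field K] (n : ℕ) :
    PathKoszul.pathHilbert K n *
        PowerSeries.evalNegHom (PathKoszul.chDualHilbert K n) = 1 ∧
      ∀ i : ℕ, PowerSeries.coeff i (PathKoszul.chDualHilbert K n) =
        ∑ j ∈ Finset.range (i + 1),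
          (PathKoszul.pathMatchings n j : ℤ) * ((n - 2 * j).choose (i - j) : ℤ) :=
  ⟨PathKoszul.pathHilbert_mul K n, PathKoszul.coeff_chDualHilbert_eq_sum K n⟩
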